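/- **Setting.** Fix a constant field $H=(h,0,0)$ with $h>0$, constants $\alpha_0>0$, $T_0\in\mathbb R$, an open set $I\subset\mathbb R$ of temperatures, and continuous functions $\alpha_4,\beta,\lambda_1,m_0$ of $T\in I$ with $\alpha_4,\beta,\lambda_1>0$ (they may be constant); $\alpha_2(T)=\alpha_0(T-T_0)$. Put $$a_2=\alpha_4m_0-\beta h,\quad \beta_1=\lambda_1+6\beta hm_0-3\alpha_4m_0^2-\alpha_2,\quad \beta_2=2\beta hm_0-\alpha_4m_0^2-\alpha_2 .$$ For the unknown $M=(M_1,M_2,M_3)\in\mathbb R^3$ consider the system $$\begin{aligned}\dot M_1&=\beta_1M_1-2a_2M_1^2-a_2|M|^2-\alpha_4|M|^2M_1,\\ \dot M_i&=\beta_2M_i-2a_2M_1M_i-\alpha_4|M|^2M_i\qquad(i=2,3).\end{aligned}\tag{S}$$ When $(m_0,0,0)$ is a steady state of the revised Ginzburg–Landau system $\dot M_i=-\alpha_2M_i+\lambda_1M_1\delta_{i1}-\alpha_4|M|^2M_i+\beta|M|^2h\,\delta_{i1}+2\beta hM_1M_i+h\,\delta_{i1}$, (S) is that system shifted by $(m_0,0,0)$.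 Let $\tau(T)=T_0+\alpha_0^{-1}(\lambda_1+6\beta hm_0-3\alpha_4m_0^2)$, so that $\beta_1=\alpha_0(\tau(T)-T)$. Let $T_1\in I$ be the critical temperature: $T_1=\tau(T_1)$, and for $T\in I$, $T<\tau(T)$ if $T<T_1$ and $T>\tau(T)$ if $T>T_1$ (this is automatic, with $T_1=\tau$, if the coefficients do not depend on $T$). Let $E=\{(M_1,0,0)\}$ and $$x_\pm=\frac{-3a_2\pm\sqrt{9a_2^2+4\alpha_4\beta_1}}{2\alpha_4}.$$ *Transition (on $T<T_1$)* means: for $T>T_1$ near $T_1$, $M=0$ is locally asymptotically stable; and there are a neighbourhood $U$ of $0$, independent of $T$, and numbers $\delta(T)>0$ having a limit $\ge 0$ as $T\uparrow T_1$ such that for $T<T_1$ near $T_1$ the stable manifold $\Gamma_T$ of $0$ (the set of initial values whose solutions tend to $0$) has codimension at least $1$ and all solutions starting in $U\setminus\Gamma_T$ satisfy $\limsup_{t\to\infty}|M(t)|\ge\delta(T)$. It is *of Type III (mixed)* if moreover some neighbourhood $U$ of $0$, independent of $T$, contains, for every $T<T_1$ near $T_1$, disjoint open sets $U_1^T,U_2^T$,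 each having $0$ in its closure, with $\overline U=\overline{U_1^T}\cup\overline{U_2^T}$, such that $\limsup_{t\to\infty}|M(t)|\le\rho(T)$ for initial values in $U_1^T$, where $\rho(T)\to0$ as $T\uparrow T_1$, and $\limsup_{t\to\infty}|M(t)|\ge\delta$ for initial values in $U_2^T$, where $\delta>0$ is independent of $T$. It *occurs in $E$* if, for $T$ near $T_1$, $E$ is invariant and attracts all solutions starting in a neighbourhood of $0$ independent of $T$, and (S) restricted to $E$ has a Type-III transition at $T_1$. **Theorem.** Assume that at $T=T_1$ we have $\lambda_1>2m_0(\alpha_4m_0-2\beta h)$ and $a_2\ne0$. Then (S) has a Type-III (mixed) transition at $T=T_1$, and the transition occurs in $E$. Moreover $9a_2^2+4\alpha_4\beta_1>0$ for $T$ near $T_1$, and: 1. For $T\ne T_1$ near $T_1$, (S) has exactly two asymptotically stable equilibria, $(M_1^+,0,0)$ and $(M_1^-,0,0)$. For $T<T_1$, $M_1^\pm=x_\pm$. For $T>T_1$, $M_1^+=0$ and $M_1^-=x_-$ if $a_2(T_1)>0$, while $M_1^+=x_+$ and $M_1^-=0$ if $a_2(T_1)<0$. 2. For every $T\in I$ with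 $T<T_1$, the basins along $E$ are: $0<M_1<\infty$ for $x_+$, and $-\infty<M_1<0$ for $x_-$. 3. For every $T\in I$ with $T>T_1$, $a_2>0$ and $9a_2^2+4\alpha_4\beta_1>0$, the basins along $E$ are: $-b<M_1<\infty$ for $M_1^+=0$, and $-\infty<M_1<-b$ for $M_1^-=x_-$, where $b=\frac1{2\alpha_4}\bigl[3a_2-\sqrt{9a_2^2+4\alpha_4\beta_1}\bigr]>0$. If instead $a_2<0$, the mirror image holds: $-\infty<M_1<b'$ for $M_1^-=0$, and $b'<M_1<\infty$ for $M_1^+=x_+$, where $b'=\frac1{2\alpha_4}\bigl[-3a_2-\sqrt{9a_2^2+4\alpha_4\beta_1}\bigr]>0$. -/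

import Mathlib

open Set Filter Topology
open scoped ENNReal

noncomputable section

namespace DynTransition

variable {X : Type*} [NormedAddCommGroup X] [NormedSpace ℝ X]

/-- `u` solves the initial value problem `du/dt = F u`, `u 0 = φ` on `[0, ∞)`. -/
def IsSolution (F : X → X) (φ : X) (u : ℝ → X) : Prop :=
  u 0 = φ ∧ ∀ t : ℝ, 0 ≤ t → HasDerivWithinAt u (F (u t)) (Ici 0) t

/-- The initial value problem has a solution on `[0, ∞)`, and every such solution has
property `P`. For a locally Lipschitz `F` this says that the (unique) solution exists for
all positive times and has property `P`. -/
def TheSolution (F : X → X) (φ : X) (P : (ℝ → X) → Prop) : Prop :=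
  (∃ u, IsSolution F φ u) ∧ ∀ u, IsSolution F φ u → P u

/-- The set of initial values whose solution converges to `p`. -/
def basin (F : X → X) (p : X) : Set X :=
  {φ | TheSolution F φ fun u => Tendsto u atTop (𝓝 p)}

/-- Local asymptotic stability (Lyapunov stability and local attraction) of the
equilibrium `p`. -/
def IsAsymptoticallyStable (F : X → X) (p : X) : Prop :=
  F p = 0 ∧
  (∀ ε : ℝ, 0 < ε → ∃ δ : ℝ, 0 < δ ∧ ∀ φ ∈ Metric.ball p δ,
    TheSolution F φ fun u => ∀ t : ℝ, 0 ≤ t → u t ∈ Metric.ball p ε) ∧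
  ∃ δ : ℝ, 0 < δ ∧ Metric.ball p δ ⊆ basin F p

/-- The stable manifold of the equilibrium `0`. -/
def stableManifold (F : X → X) : Set X := basin F 0

/-- `limsup ‖u t‖` as `t → ∞`, with values in `[0, ∞]`. -/
def limsupNorm (u : ℝ → X) : ℝ≥0∞ := limsup (fun t => ‖u t‖ₑ) atTop

/-- The family `du/dt = V T u` has a transition from `u = 0` at `T = T₁`, on the side
`T < T₁`: the state `0` is locally asymptotically stable for `T > T₁`; for `T < T₁` its
stable manifold has codimension at least one (in terms of Hausdorff dimension) and all
solutions that start off the stable manifold, in a neighbourhood `U` of `0` independent of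
`T`, satisfy `limsup ‖u‖ ≥ δ T > 0`, where `δ T` has a limit as `T → T₁`. As usual,
`T` is understood to be near `T₁`. -/
def HasTransitionBelow (V : ℝ → X → X) (T₁ : ℝ) : Prop :=
  (∀ᶠ T in 𝓝 T₁, V T 0 = 0) ∧
  (∀ᶠ T in 𝓝[>] T₁, IsAsymptoticallyStable (V T) 0) ∧
  ∃ U ∈ 𝓝 (0 : X), ∃ δ : ℝ → ℝ, ∃ d : ℝ, 0 ≤ d ∧ Tendsto δ (𝓝[<] T₁) (𝓝 d) ∧
    ∀ᶠ T in 𝓝[<] T₁, 0 < δ T ∧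
      dimH (stableManifold (V T)) + 1 ≤ (Module.finrank ℝ X : ℝ≥0∞) ∧
      ∀ φ ∈ U \ stableManifold (V T),
        TheSolution (V T) φ fun u => ENNReal.ofReal (δ T) ≤ limsupNorm u

/-- The family `du/dt = V T u` has a mixed (Type-III) transition from `u = 0` at `T = T₁`,
on the side `T < T₁`: it has a transition there, and a neighbourhood `U` of `0`
independent of `T` decomposes, for `T < T₁` near `T₁`, into two disjoint open sets,
both touching `0`, with `closure U` the union of their closures. For initial values in
`U₁ T` the transition is continuous (`limsup ‖u‖` tends to `0` as `T → T₁`), and for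
initial values in `U₂ T` it is a jump (`limsup ‖u‖ ≥ δ > 0` with `δ` independent of `T`). -/
def HasMixedTransitionBelow (V : ℝ → X → X) (T₁ : ℝ) : Prop :=
  HasTransitionBelow V T₁ ∧
  ∃ U : Set X, IsOpen U ∧ (0 : X) ∈ U ∧ ∃ U₁ U₂ : ℝ → Set X,
    ∃ ρ : ℝ → ℝ≥0∞, Tendsto ρ (𝓝[<] T₁) (𝓝 0) ∧ ∃ δ : ℝ, 0 < δ ∧
    ∀ᶠ T in 𝓝[<] T₁,
      IsOpen (U₁ T) ∧ IsOpen (U₂ T) ∧ U₁ T ⊆ U ∧ U₂ T ⊆ U ∧ Disjoint (U₁ T) (U₂ T) ∧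
      (0 : X) ∈ closure (U₁ T) ∧ (0 : X) ∈ closure (U₂ T) ∧
      closure U = closure (U₁ T) ∪ closure (U₂ T) ∧
      (∀ φ ∈ U₁ T, TheSolution (V T) φ fun u => limsupNorm u ≤ ρ T) ∧
      ∀ φ ∈ U₂ T, TheSolution (V T) φ fun u => ENNReal.ofReal δ ≤ limsupNorm u

/-- The mixed transition of `du/dt = V T u` at `T = T₁` occurs in the linear subspace `S`:
for `T` near `T₁` the subspace is invariant, it attracts all solutions that start in a
neighbourhood of `0` independent of `T`, and the system restricted to `S` has the mixed
transition. (On an invariant `S` the vector field is tangent to `S`, so that the orthogonal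
projection in the restricted system leaves it unchanged.) -/
def MixedTransitionOccursIn {X : Type*} [NormedAddCommGroup X] [InnerProductSpace ℝ X]
    (V : ℝ → X → X) (T₁ : ℝ) (S : Submodule ℝ X) [S.HasOrthogonalProjection] : Prop :=
  (∀ᶠ T in 𝓝 T₁, ∀ φ ∈ S, V T φ ∈ S ∧
    TheSolution (V T) φ fun u => ∀ t : ℝ, 0 ≤ t → u t ∈ S) ∧
  (∃ U ∈ 𝓝 (0 : X), ∀ᶠ T in 𝓝 T₁, ∀ φ ∈ U,
    TheSolution (V T) φ fun u =>
      Tendsto (fun t => Metric.infDist (u t) (S : Set X)) atTop (𝓝 0)) ∧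
  HasMixedTransitionBelow (fun T (x : S) => S.orthogonalProjectionOnto (V T (x : X))) T₁

end DynTransition


/-- The space of magnetizations `M = (M₁, M₂, M₃)`, with the Euclidean norm. -/
abbrev Magnetization := EuclideanSpace ℝ (Fin 3)

/-- The coefficients of the revised Ginzburg-Landau model of an isotropic ferromagnet in a
fixed constant field `H = (h, 0, 0)`. The coefficients `α₄`, `β`, `lam₁` and the first
component `m₀` of the steady state `M* = (m₀, 0, 0)` may depend on the temperature. -/
structure Ferromagnet where
  h : ℝ
  α₀ : ℝ
  T₀ : ℝ
  α₄ : ℝ → ℝ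
  β : ℝ → ℝ
  lam₁ : ℝ → ℝ
  m₀ : ℝ → ℝ

namespace Ferromagnet

open DynTransition

variable (P : Ferromagnet)

def α₂ (T : ℝ) : ℝ := P.α₀ * (T - P.T₀)

def a₂ (T : ℝ) : ℝ := P.α₄ T * P.m₀ T - P.β T * P.h

def β₁ (T : ℝ) : ℝ :=
  P.lam₁ T + 6 * P.β T * P.h * P.m₀ T - 3 * P.α₄ T * P.m₀ T ^ 2 - P.α₂ T

def β₂ (T : ℝ) : ℝ :=
  2 * P.β T * P.h * P.m₀ T - P.α₄ T * P.m₀ T ^ 2 - P.α₂ T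

/-- Standing assumptions on the model for temperatures in `I`: positivity and continuity of
the coefficients. -/
structure Admissible (I : Set ℝ) : Prop where
  h_pos : 0 < P.h
  α₀_pos : 0 < P.α₀
  α₄_pos : ∀ T ∈ I, 0 < P.α₄ T
  β_pos : ∀ T ∈ I, 0 < P.β T
  lam₁_pos : ∀ T ∈ I, 0 < P.lam₁ T
  α₄_cont : ContinuousOn P.α₄ I
  β_cont : ContinuousOn P.β I
  lam₁_cont : ContinuousOn P.lam₁ I
  m₀_cont : ContinuousOn P.m₀ I

/-- The right-hand side of the unshifted system for the magnetization. -/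
def originalField (T : ℝ) (M : Magnetization) : Magnetization :=
  !₂[(P.lam₁ T - P.α₂ T) * M 0 + P.β T * P.h * ‖M‖ ^ 2 + 2 * P.β T * P.h * M 0 ^ 2
        - P.α₄ T * ‖M‖ ^ 2 * M 0 + P.h,
     -P.α₂ T * M 1 + 2 * P.β T * P.h * M 0 * M 1 - P.α₄ T * ‖M‖ ^ 2 * M 1,
     -P.α₂ T * M 2 + 2 * P.β T * P.h * M 0 * M 2 - P.α₄ T * ‖M‖ ^ 2 * M 2]

/-- The right-hand side of the shifted system, for the deviation of the magnetization from
the steady state `(m₀, 0, 0)`. -/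
def shiftedField (T : ℝ) (M : Magnetization) : Magnetization :=
  !₂[P.β₁ T * M 0 - 2 * P.a₂ T * M 0 ^ 2 - P.a₂ T * ‖M‖ ^ 2 - P.α₄ T * ‖M‖ ^ 2 * M 0,
     P.β₂ T * M 1 - 2 * P.a₂ T * M 0 * M 1 - P.α₄ T * ‖M‖ ^ 2 * M 1,
     P.β₂ T * M 2 - 2 * P.a₂ T * M 0 * M 2 - P.α₄ T * ‖M‖ ^ 2 * M 2]

/-- The point `(x, 0, 0)`. -/
def onAxis (x : ℝ) : Magnetization := !₂[x, 0, 0]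

/-- If `(m₀, 0, 0)` is a steady state of the original system, then the substitution
`M = (m₀, 0, 0) + M'` turns the original system into the shifted one. -/
theorem originalField_shift (T : ℝ) (hs : P.originalField T (onAxis (P.m₀ T)) = 0)
    (M : Magnetization) :
    P.originalField T (onAxis (P.m₀ T) + M) = P.shiftedField T M := by
  have h0 := congrArg (fun v : Magnetization => v 0) hs
  simp [originalField, onAxis, EuclideanSpace.norm_sq_eq, Fin.sum_univ_three] at h0
  ext i
  fin_cases i
  · simp [originalField, shiftedField, onAxis, EuclideanSpace.norm_sq_eq,
      Fin.sum_univ_three, a₂, β₁]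
    linear_combination h0
  · simp [originalField, shiftedField, onAxis, EuclideanSpace.norm_sq_eq,
      Fin.sum_univ_three, a₂, β₂]
    ring
  · simp [originalField, shiftedField, onAxis, EuclideanSpace.norm_sq_eq,
      Fin.sum_univ_three, a₂, β₂]
    ring

/-- The critical parameter curve `β₁ = 0`, solved for the temperature. -/
def criticalCurve (T : ℝ) : ℝ :=
  P.T₀ + (1 / P.α₀) * (P.lam₁ T + 6 * P.β T * P.h * P.m₀ T - 3 * P.α₄ T * P.m₀ T ^ 2)

/-- `T₁` is the critical temperature (among the temperatures in `I`): it lies on the critical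
curve, lower temperatures lie below the curve and higher temperatures above it. -/
def IsCriticalTemperature (I : Set ℝ) (T₁ : ℝ) : Prop :=
  T₁ ∈ I ∧ T₁ = P.criticalCurve T₁ ∧
  ∀ T ∈ I, (T < T₁ → T < P.criticalCurve T) ∧ (T₁ < T → P.criticalCurve T < T)

/-- If the critical curve does not depend on the temperature (for instance, if none of
`α₄`, `β`, `lam₁`, `m₀` does), its value is the critical temperature. -/
theorem isCriticalTemperature_of_const (T₁ : ℝ) (hc : ∀ T, P.criticalCurve T = T₁) :
    P.IsCriticalTemperature univ T₁ :=
  ⟨mem_univ _, (hc T₁).symm, fun T _ => by rw [hc T]; exact ⟨id, id⟩⟩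

/-- The line `E = {(M₁, 0, 0)}`. -/
def axis : Submodule ℝ Magnetization := Submodule.span ℝ {onAxis 1}

/-- The set of those `x` for which the solution of the shifted system that starts at
`(x, 0, 0)` converges to `(p, 0, 0)`. -/
def axisBasin (T p : ℝ) : Set ℝ := {x | onAxis x ∈ basin (P.shiftedField T) (onAxis p)}

/-- The quantity under the square root. -/
def disc (T : ℝ) : ℝ := 9 * P.a₂ T ^ 2 + 4 * P.α₄ T * P.β₁ T

/-- `(-3a₂ + √(9a₂² + 4α₄β₁)) / (2α₄)` -/
def rootPlus (T : ℝ) : ℝ := 1 / (2 * P.α₄ T) * (-3 * P.a₂ T + √(P.disc T))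

/-- `-(3a₂ + √(9a₂² + 4α₄β₁)) / (2α₄)` -/
def rootMinus (T : ℝ) : ℝ := -(1 / (2 * P.α₄ T)) * (3 * P.a₂ T + √(P.disc T))

/-- The points `(p, 0, 0)` and `(q, 0, 0)` are two different equilibria of the
shifted system in `ℝ³`, and they are precisely its asymptotically stable equilibria. -/
def StableStatesAre (T p q : ℝ) : Prop :=
  p ≠ q ∧ ∀ M : Magnetization,
    IsAsymptoticallyStable (P.shiftedField T) M ↔ M = onAxis p ∨ M = onAxis q

end Ferromagnet

end

open DynTransition

/-! The system is the gradient flow of a quartic potential, and the term `-α₄|M|²M` makes it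
dissipative. Hence solutions are global and bounded, and the field tends to zero along each of them
(`IsDissipative.tendsto_field_of_gradient`). Near `T₁` one has `β₂ < 0` and `β₂ < β₁`. An algebraic
elimination (`abs_transverse_le`) then bounds the transverse coordinates by the field, so every
solution approaches the axis, and its axial coordinate `x` satisfies `f(x) → 0` for the cubic `f(x)
= β₁x - 3a₂x² - α₄x³`. No center manifold reduction is needed.

For `T ≠ T₁` near `T₁` the cubic has three simple real roots, one of them `0`. On the axis the outer
roots attract and the middle one separates their basins. The outer roots are also transversally
stable (`AxisRoots.stable_iff`).

Let `T < T₁`, so that `0` is the middle root, and let `a₂ > 0`. With `r` the distance to the axis,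
`x' = f(x) - (a₂ + α₄x)r²`, which is negative for small negative `x`. A solution that ever has `x <
0` therefore converges to the far state `x₋` (`AxisRoots.tendsto_of_neg`). All others keep `x ≥ 0`
and have limsup at most `x₊`, which tends to `0` as `T ↑ T₁`
(`AxisRoots.limsupNorm_le_of_notMem_left`). The open basin of the far state is the jump region, and
the complement of its closure is the continuous region. The case `a₂ < 0` follows from the
reflection `M ↦ -M`.

The stable set of `0` has dimension at most two by a cone argument
(`IsDissipative.dimH_basin_zero_le`): differences of two solutions in it can never lie in the open
cone around the axis once both solutions stay near `0`. -/

open DynTransition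

/-! ### Scalar differential inequalities -/

section ScalarInequalities

/-- Grönwall's inequality, without a sign condition on `D` or `k`: applied to minus a squared
distance it also gives lower bounds. -/
theorem le_mul_exp_of_deriv_le {D D' : ℝ → ℝ} {a b k : ℝ} (hab : a ≤ b)
    (hD : ∀ t ∈ Icc a b, HasDerivWithinAt D (D' t) (Icc a b) t)
    (hk : ∀ t ∈ Icc a b, D' t ≤ k * D t) : D b ≤ D a * Real.exp (k * (b - a)) := by
  have hE : ∀ t ∈ Icc a b, HasDerivWithinAt (fun t => D t * Real.exp (-k * t))
      (D' t * Real.exp (-k * t) + D t * (Real.exp (-k * t) * (-k * 1))) (Icc a b) t := by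
    intro t ht
    exact (hD t ht).mul (((hasDerivAt_id t).const_mul (-k)).exp.hasDerivWithinAt)
  have hanti : AntitoneOn (fun t => D t * Real.exp (-k * t)) (Icc a b) := by
    refine antitoneOn_of_hasDerivWithinAt_nonpos (convex_Icc a b)
      (fun t ht => (hE t ht).continuousWithinAt)
      (fun t ht => (hE t (interior_subset ht)).mono interior_subset) fun t ht => ?_
    have := mul_nonneg (sub_nonneg.2 (hk t (interior_subset ht))) (Real.exp_pos (-k * t)).le
    linarith
  have h := hanti (left_mem_Icc.2 hab) (right_mem_Icc.2 hab) hab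
  have h2 := mul_le_mul_of_nonneg_right h (Real.exp_pos (k * b)).le
  simp only [mul_assoc, ← Real.exp_add] at h2
  rw [show -k * b + k * b = 0 by ring, show -k * a + k * b = k * (b - a) by ring,
    Real.exp_zero, mul_one] at h2
  exact h2

theorem mul_sub_le_of_le_deriv {D D' : ℝ → ℝ} {a b m : ℝ} (hab : a ≤ b)
    (hD : ∀ t ∈ Icc a b, HasDerivWithinAt D (D' t) (Icc a b) t)
    (hm : ∀ t ∈ Icc a b, m ≤ D' t) : m * (b - a) ≤ D b - D a := by
  have hmono : MonotoneOn (fun t => D t - m * t) (Icc a b) := by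
    refine monotoneOn_of_hasDerivWithinAt_nonneg (convex_Icc a b) (f' := fun t => D' t - m * 1)
      (fun t ht => ((hD t ht).continuousWithinAt.sub (by fun_prop)))
      (fun t ht => ?_) fun t ht => ?_
    · exact ((hD t (interior_subset ht)).sub
        ((hasDerivAt_id t).const_mul m).hasDerivWithinAt).mono interior_subset
    · linarith [hm t (interior_subset ht)]
  have := hmono (left_mem_Icc.2 hab) (right_mem_Icc.2 hab) hab
  simp only at this
  linarith

/-- The barrier principle behind all trapping regions below: the sign of the derivative matters only
on the level itself. -/
theorem le_of_deriv_neg_at_level {D D' : ℝ → ℝ} {a b l : ℝ}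
    (hD : ∀ t ∈ Icc a b, HasDerivWithinAt D (D' t) (Icc a b) t) (h0 : D a ≤ l)
    (hl : ∀ t ∈ Icc a b, D t = l → D' t < 0) : ∀ t ∈ Icc a b, D t ≤ l := by
  refine image_le_of_deriv_right_lt_deriv_boundary (B := fun _ => l) (B' := fun _ => 0)
    (f' := D') (fun t ht => (hD t ht).continuousWithinAt) (fun t ht => ?_) h0
    (fun t => hasDerivAt_const t l) fun t ht => hl t (Ico_subset_Icc_self ht)
  exact (hD t (Ico_subset_Icc_self ht)).mono_of_mem_nhdsWithin (Icc_mem_nhdsGE_of_mem ht)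

end ScalarInequalities

/-! ### Global existence, uniqueness and stability for dissipative fields -/

section Flow

open scoped RealInnerProductSpace

variable {X : Type*} [NormedAddCommGroup X] [InnerProductSpace ℝ X] {F : X → X}

theorem norm_le_of_inward {u : ℝ → X} {a b M : ℝ}
    (hu : ∀ t ∈ Icc a b, HasDerivWithinAt u (F (u t)) (Icc a b) t) (h0 : ‖u a‖ ≤ M)
    (hF : ∀ x, ‖x‖ = M → ⟪x, F x⟫ < 0) : ∀ t ∈ Icc a b, ‖u t‖ ≤ M := by
  have hM : 0 ≤ M := (norm_nonneg _).trans h0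
  intro t ht
  have := le_of_deriv_neg_at_level (D := fun t => ‖u t‖ ^ 2) (l := M ^ 2)
    (fun t ht => (hu t ht).norm_sq) (pow_le_pow_left₀ (norm_nonneg _) h0 2)
    (fun t _ h => by
      have := hF (u t) ((sq_eq_sq₀ (norm_nonneg _) hM).1 h)
      linarith) t ht
  exact (sq_le_sq₀ (norm_nonneg _) hM).1 this

theorem norm_sub_sq_hasDerivWithinAt {u v : ℝ → X} {s : Set ℝ} {t : ℝ}
    (hu : HasDerivWithinAt u (F (u t)) s t) (hv : HasDerivWithinAt v (F (v t)) s t) :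
    HasDerivWithinAt (fun t => ‖u t - v t‖ ^ 2) (2 * ⟪u t - v t, F (u t) - F (v t)⟫) s t :=
  (hu.sub hv).norm_sq

theorem abs_inner_sub_le_of_lipschitzOnWith {S : Set X} {K : NNReal}
    (hK : LipschitzOnWith K F S) {x y : X} (hx : x ∈ S) (hy : y ∈ S) :
    |⟪x - y, F x - F y⟫| ≤ K * ‖x - y‖ ^ 2 := by
  refine (abs_real_inner_le_norm _ _).trans ?_
  have := hK.norm_sub_le hx hy
  nlinarith [norm_nonneg (x - y)]

theorem norm_sub_sq_le_of_lipschitzOnWith {S : Set X} {K : NNReal} (hK : LipschitzOnWith K F S)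
    {u v : ℝ → X} {a b : ℝ} (hab : a ≤ b)
    (hu : ∀ t ∈ Icc a b, HasDerivWithinAt u (F (u t)) (Icc a b) t)
    (hv : ∀ t ∈ Icc a b, HasDerivWithinAt v (F (v t)) (Icc a b) t)
    (huS : ∀ t ∈ Icc a b, u t ∈ S) (hvS : ∀ t ∈ Icc a b, v t ∈ S) :
    ‖u b - v b‖ ^ 2 ≤ ‖u a - v a‖ ^ 2 * Real.exp (2 * K * (b - a)) := by
  refine le_mul_exp_of_deriv_le (D := fun t => ‖u t - v t‖ ^ 2) hab
    (fun t ht => norm_sub_sq_hasDerivWithinAt (hu t ht) (hv t ht)) fun t ht => ?_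
  have := (abs_le.1 (abs_inner_sub_le_of_lipschitzOnWith hK (huS t ht) (hvS t ht))).2
  linarith

/-- The backward counterpart of the Lipschitz dependence on initial values: solutions separate at
most exponentially in reversed time. -/
theorem le_norm_sub_sq_of_lipschitzOnWith {S : Set X} {K : NNReal} (hK : LipschitzOnWith K F S)
    {u v : ℝ → X} {a b : ℝ} (hab : a ≤ b)
    (hu : ∀ t ∈ Icc a b, HasDerivWithinAt u (F (u t)) (Icc a b) t)
    (hv : ∀ t ∈ Icc a b, HasDerivWithinAt v (F (v t)) (Icc a b) t)
    (huS : ∀ t ∈ Icc a b, u t ∈ S) (hvS : ∀ t ∈ Icc a b, v t ∈ S) :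
    ‖u a - v a‖ ^ 2 * Real.exp (-2 * K * (b - a)) ≤ ‖u b - v b‖ ^ 2 := by
  have := le_mul_exp_of_deriv_le (D := fun t => -‖u t - v t‖ ^ 2) (k := -2 * K) hab
    (fun t ht => (norm_sub_sq_hasDerivWithinAt (hu t ht) (hv t ht)).neg) fun t ht => by
      have := (abs_le.1 (abs_inner_sub_le_of_lipschitzOnWith hK (huS t ht) (hvS t ht))).1
      linarith
  simp only [neg_mul] at this ⊢
  linarith

theorem eqOn_of_lipschitzOnWith {S : Set X} {K : NNReal} (hK : LipschitzOnWith K F S)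
    {u v : ℝ → X} {a b : ℝ}
    (hu : ∀ t ∈ Icc a b, HasDerivWithinAt u (F (u t)) (Icc a b) t)
    (hv : ∀ t ∈ Icc a b, HasDerivWithinAt v (F (v t)) (Icc a b) t)
    (huS : ∀ t ∈ Icc a b, u t ∈ S) (hvS : ∀ t ∈ Icc a b, v t ∈ S) (h : u a = v a) :
    EqOn u v (Icc a b) := by
  intro t ht
  have hsub : Icc a t ⊆ Icc a b := Icc_subset_Icc_right ht.2
  have := norm_sub_sq_le_of_lipschitzOnWith hK ht.1 (fun s hs => (hu s (hsub hs)).mono hsub)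
    (fun s hs => (hv s (hsub hs)).mono hsub) (fun s hs => huS s (hsub hs))
    (fun s hs => hvS s (hsub hs))
  rw [h, sub_self, norm_zero] at this
  have h0 : ‖u t - v t‖ ^ 2 = 0 := le_antisymm (by simpa using this) (sq_nonneg _)
  exact sub_eq_zero.1 (norm_eq_zero.1 (pow_eq_zero_iff two_ne_zero |>.1 h0))

/-- A continuously differentiable vector field that points inwards far from the origin. -/
structure IsDissipative (F : X → X) : Prop where
  contDiff : ContDiff ℝ 1 F
  inward : ∃ R : ℝ, ∀ x, R ≤ ‖x‖ → ⟪x, F x⟫ < 0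

theorem DynTransition.IsSolution.hasDerivWithinAt_Icc {φ : X} {u : ℝ → X} (hu : IsSolution F φ u)
    {a b : ℝ} (ha : 0 ≤ a) : ∀ t ∈ Icc a b, HasDerivWithinAt u (F (u t)) (Icc a b) t :=
  fun t ht => (hu.2 t (ha.trans ht.1)).mono fun _ hs => ha.trans hs.1

theorem DynTransition.IsSolution.continuousOn {φ : X} {u : ℝ → X} (hu : IsSolution F φ u) :
    ContinuousOn u (Ici 0) := fun t ht => (hu.2 t ht).continuousWithinAt

theorem DynTransition.IsSolution.shift {φ : X} {u : ℝ → X} (hu : IsSolution F φ u)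
    {a : ℝ} (ha : 0 ≤ a) : IsSolution F (u a) (fun t => u (a + t)) := by
  refine ⟨by simp, fun t ht => ?_⟩
  have h1 := hu.2 (a + t) (add_nonneg ha ht)
  have h2 : HasDerivWithinAt (fun t => a + t) 1 (Ici 0) t :=
    (hasDerivWithinAt_id t _).const_add a
  have := h1.scomp t h2 (fun s hs => add_nonneg ha hs)
  simpa using! this

/-- A bound for all solutions starting in a ball. -/
theorem IsDissipative.exists_bound (hF : IsDissipative F) (r : ℝ) :
    ∃ M, r ≤ M ∧ 0 < M ∧ ∀ x, ‖x‖ = M → ⟪x, F x⟫ < 0 := by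
  obtain ⟨R, hR⟩ := hF.inward
  exact ⟨max (max r R) 1, by simp, by simp, fun x hx => hR x (by rw [hx]; simp)⟩

theorem DynTransition.IsSolution.norm_le {φ : X} {u : ℝ → X} (hu : IsSolution F φ u) {M : ℝ}
    (hφ : ‖φ‖ ≤ M) (hM : ∀ x, ‖x‖ = M → ⟪x, F x⟫ < 0) {t : ℝ} (ht : 0 ≤ t) : ‖u t‖ ≤ M :=
  norm_le_of_inward (hu.hasDerivWithinAt_Icc le_rfl) (by rwa [hu.1]) hM t (right_mem_Icc.2 ht)

theorem disjoint_basin {p q : X} (hpq : p ≠ q) : Disjoint (basin F p) (basin F q) :=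
  Set.disjoint_left.2 fun _ ⟨⟨u, hu⟩, hp⟩ hq => hpq (tendsto_nhds_unique (hp u hu) (hq.2 u hu))

variable [FiniteDimensional ℝ X]

theorem IsDissipative.exists_lipschitzOnWith (hF : IsDissipative F) (M : ℝ) :
    ∃ K, LipschitzOnWith K F (Metric.closedBall 0 M) :=
  hF.contDiff.contDiffOn.exists_lipschitzOnWith one_ne_zero (convex_closedBall 0 M)
    (isCompact_closedBall 0 M)

theorem IsDissipative.eqOn (hF : IsDissipative F) {φ : X} {u v : ℝ → X} {M N : ℝ}
    (hu : ∀ t ∈ Icc 0 N, HasDerivWithinAt u (F (u t)) (Icc 0 N) t)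
    (hv : ∀ t ∈ Icc 0 N, HasDerivWithinAt v (F (v t)) (Icc 0 N) t)
    (huM : ∀ t ∈ Icc 0 N, ‖u t‖ ≤ M) (hvM : ∀ t ∈ Icc 0 N, ‖v t‖ ≤ M)
    (hu0 : u 0 = φ) (hv0 : v 0 = φ) : EqOn u v (Icc 0 N) := by
  obtain ⟨K, hK⟩ := hF.exists_lipschitzOnWith M
  exact eqOn_of_lipschitzOnWith hK hu hv (fun t ht => by simpa using huM t ht)
    (fun t ht => by simpa using hvM t ht) (hu0.trans hv0.symm)

theorem IsDissipative.unique (hF : IsDissipative F) {φ : X} {u v : ℝ → X}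
    (hu : IsSolution F φ u) (hv : IsSolution F φ v) {t : ℝ} (ht : 0 ≤ t) : u t = v t := by
  obtain ⟨M, hφM, -, hM⟩ := hF.exists_bound ‖φ‖
  exact hF.eqOn (hu.hasDerivWithinAt_Icc le_rfl) (hv.hasDerivWithinAt_Icc le_rfl)
    (fun t ht => hu.norm_le hφM hM ht.1) (fun t ht => hv.norm_le hφM hM ht.1) hu.1 hv.1
    (right_mem_Icc.2 ht)

theorem IsDissipative.exists_solution_Icc (hF : IsDissipative F) {φ : X} {M : ℝ}
    (hφ : ‖φ‖ ≤ M) (hM0 : 0 < M) (hM : ∀ x, ‖x‖ = M → ⟪x, F x⟫ < 0) (N : ℝ) (hN : 0 ≤ N) :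
    ∃ u : ℝ → X, u 0 = φ ∧ (∀ t ∈ Icc 0 N, HasDerivWithinAt u (F (u t)) (Icc 0 N) t) ∧
      ∀ t ∈ Icc 0 N, ‖u t‖ ≤ M := by
  -- The cut-off field is bounded and globally Lipschitz, so Picard–Lindelöf covers all of `[0, N]`
  -- at once. Inwardness on the sphere of radius `M` keeps the solution where the cut-off equals
  -- `1`.
  let χ : ContDiffBump (0 : X) := ⟨M, M + 1, hM0, by linarith⟩
  let G : X → X := fun x => χ x • F x
  have hGC : ContDiff ℝ 1 G := (χ.contDiff (n := 1)).smul hF.contDiff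
  have hGs : HasCompactSupport G := χ.hasCompactSupport.smul_right
  obtain ⟨K, hK⟩ := ContDiff.lipschitzWith_of_hasCompactSupport hGs hGC one_ne_zero
  obtain ⟨C, hC⟩ := hGs.exists_bound_of_continuous hGC.continuous
  have hC0 : 0 ≤ C := (norm_nonneg _).trans (hC 0)
  have hG : ∀ x, ‖x‖ ≤ M → G x = F x := fun x hx => by
    have : χ x = 1 := χ.one_of_mem_closedBall (by simpa [χ] using hx)
    simp [G, this]
  have hPL : IsPicardLindelof (fun _ => G) (tmin := 0) (tmax := N) ⟨0, le_rfl, hN⟩ φ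
      ⟨C * N, by positivity⟩ 0 ⟨C, hC0⟩ K :=
    .of_time_independent (fun x _ => hC x) hK.lipschitzOnWith (by simp [hN]; rfl)
  obtain ⟨u, hu0, hu⟩ := hPL.exists_eq_forall_mem_Icc_hasDerivWithinAt₀
  have hb := norm_le_of_inward hu (by simpa [hu0] using hφ)
    (fun x hx => by rw [hG x hx.le]; exact hM x hx)
  exact ⟨u, hu0, fun t ht => by rw [← hG _ (hb t ht)]; exact hu t ht, hb⟩

theorem IsDissipative.exists_solution (hF : IsDissipative F) (φ : X) :
    ∃ u, IsSolution F φ u := by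
  obtain ⟨M, hφM, hM0, hM⟩ := hF.exists_bound ‖φ‖
  have h := fun n : ℕ => hF.exists_solution_Icc hφM hM0 hM ((n : ℝ) + 1) (by positivity)
  choose w hw0 hw hwM using h
  have hcomp : ∀ {m n : ℕ}, m ≤ n → ∀ t ∈ Icc (0 : ℝ) (m + 1), w m t = w n t := by
    intro m n hmn
    have hsub : Icc (0 : ℝ) (m + 1) ⊆ Icc 0 (n + 1) :=
      Icc_subset_Icc_right (by simpa using hmn)
    exact hF.eqOn (hw m) (fun t ht => (hw n t (hsub ht)).mono hsub) (hwM m)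
      (fun t ht => hwM n t (hsub ht)) (hw0 m) (hw0 n)
  -- `w n` lives on `[0, n + 1]`, one unit more than the ceiling requires, so `t` is never the right
  -- endpoint and the derivative within `Ici 0` can be read off.
  refine ⟨fun t => w ⌈t⌉₊ t, by simp [hw0], fun t ht => ?_⟩
  have htn : t < (⌈t⌉₊ : ℝ) + 1 := (Nat.le_ceil t).trans_lt (lt_add_one _)
  have hev : ∀ᶠ s in 𝓝[Ici 0] t, s ∈ Icc (0 : ℝ) (⌈t⌉₊ + 1) := by
    filter_upwards [self_mem_nhdsWithin, nhdsWithin_le_nhds (Iio_mem_nhds htn)] with s hs hs'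
    exact ⟨hs, le_of_lt hs'⟩
  refine ((hw _ t ⟨ht, htn.le⟩).mono_of_mem_nhdsWithin hev).congr_of_eventuallyEq ?_ rfl
  filter_upwards [hev] with s hs
  have hs1 : s ∈ Icc (0 : ℝ) (⌈s⌉₊ + 1) := ⟨hs.1, (Nat.le_ceil s).trans (by linarith)⟩
  rcases le_total ⌈s⌉₊ ⌈t⌉₊ with h | h
  · exact hcomp h s hs1
  · exact (hcomp h s hs).symm

theorem IsDissipative.theSolution_iff (hF : IsDissipative F) {φ : X} {Q : (ℝ → X) → Prop} :
    TheSolution F φ Q ↔ ∀ u, IsSolution F φ u → Q u :=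
  ⟨fun h => h.2, fun h => ⟨hF.exists_solution φ, h⟩⟩

theorem IsDissipative.mem_basin_iff (hF : IsDissipative F) {φ p : X} :
    φ ∈ basin F p ↔ ∀ u, IsSolution F φ u → Tendsto u atTop (𝓝 p) :=
  hF.theSolution_iff

theorem IsDissipative.mem_basin_of_solution (hF : IsDissipative F) {φ p : X} {u : ℝ → X}
    (hu : IsSolution F φ u) (h : Tendsto u atTop (𝓝 p)) : φ ∈ basin F p :=
  hF.mem_basin_iff.2 fun v hv => h.congr' <| by
    filter_upwards [eventually_ge_atTop 0] with t ht using hF.unique hu hv ht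

/-- At some finite time the solution is within `δ / 2` of `p`. By Lipschitz dependence nearby
solutions are then inside the `δ`-ball, which lies in the basin, and the field is autonomous. -/
theorem IsDissipative.isOpen_basin (hF : IsDissipative F) {p : X}
    (hp : IsAsymptoticallyStable F p) : IsOpen (basin F p) := by
  obtain ⟨δ, hδ, hsub⟩ := hp.2.2
  refine isOpen_iff_mem_nhds.2 fun φ hφ => ?_
  obtain ⟨u, hu⟩ := hF.exists_solution φ
  have hev := (Metric.tendsto_nhds.1 (hφ.2 u hu) (δ / 2) (half_pos hδ)).and
    (eventually_ge_atTop 0)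
  obtain ⟨T, hT, hT0⟩ := hev.exists
  obtain ⟨M, hφM, hM0, hM⟩ := hF.exists_bound (‖φ‖ + 1)
  obtain ⟨K, hK⟩ := hF.exists_lipschitzOnWith M
  set E := Real.exp (K * T) with hE
  have hEpos : 0 < E := Real.exp_pos _
  have hr : 0 < min 1 (δ / 2 / E) := by positivity
  filter_upwards [Metric.ball_mem_nhds φ hr] with ψ hψ
  rw [mem_ball_iff_norm, lt_min_iff, lt_div_iff₀ hEpos] at hψ
  have hψM : ‖ψ‖ ≤ M := by
    have := norm_add_le (ψ - φ) φ
    rw [sub_add_cancel] at this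
    linarith
  obtain ⟨v, hv⟩ := hF.exists_solution ψ
  have hd := norm_sub_sq_le_of_lipschitzOnWith hK hT0 (hv.hasDerivWithinAt_Icc le_rfl)
    (hu.hasDerivWithinAt_Icc le_rfl) (fun t ht => by simpa using hv.norm_le hψM hM ht.1)
    (fun t ht => by simpa using hu.norm_le (by linarith) hM ht.1)
  rw [hv.1, hu.1, show 2 * K * (T - 0) = K * T + K * T by ring, Real.exp_add, ← hE] at hd
  have hd2 : ‖v T - u T‖ ≤ ‖ψ - φ‖ * E := by
    refine (sq_le_sq₀ (norm_nonneg _) (by positivity)).1 ?_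
    linarith
  have hmem : v T ∈ Metric.ball p δ := by
    rw [Metric.mem_ball]
    have h1 := dist_triangle (v T) (u T) p
    rw [dist_eq_norm (v T) (u T)] at h1
    linarith [hψ.2]
  refine hF.mem_basin_of_solution hv ?_
  have := (hsub hmem).2 _ (hv.shift hT0)
  refine (this.comp (tendsto_atTop_add_const_right atTop (-T) tendsto_id)).congr fun t => ?_
  simp

/-- `‖u - p‖²` is a strict Lyapunov function: every ball of radius at most `ρ` is trapping, and
inside it the function decays at rate `2k`. -/
theorem IsDissipative.isAsymptoticallyStable_of_inner_le (hF : IsDissipative F) {p : X} {k ρ : ℝ}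
    (hp : F p = 0) (hk : 0 < k) (hρ : 0 < ρ)
    (h : ∀ x, ‖x - p‖ ≤ ρ → ⟪x - p, F x⟫ ≤ -k * ‖x - p‖ ^ 2) : IsAsymptoticallyStable F p := by
  have hD : ∀ {φ : X} {u : ℝ → X} {N : ℝ}, IsSolution F φ u → ∀ t ∈ Icc 0 N,
      HasDerivWithinAt (fun t => ‖u t - p‖ ^ 2) (2 * ⟪u t - p, F (u t)⟫) (Icc 0 N) t :=
    fun hu t ht => ((hu.hasDerivWithinAt_Icc le_rfl t ht).sub_const p).norm_sq
  have key : ∀ {φ : X} {u : ℝ → X} {ε : ℝ}, IsSolution F φ u → 0 < ε → ε ≤ ρ → ‖φ - p‖ ≤ ε →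
      ∀ t, 0 ≤ t → ‖u t - p‖ ≤ ε := by
    intro φ u ε hu hε hερ hφ t ht
    have := le_of_deriv_neg_at_level (hD hu) (l := ε ^ 2)
      (by rw [hu.1]; exact pow_le_pow_left₀ (norm_nonneg _) hφ 2)
      (fun t _ hl => by
        have he : ‖u t - p‖ = ε := (sq_eq_sq₀ (norm_nonneg _) hε.le).1 hl
        have := h (u t) (by rw [he]; exact hερ)
        rw [he] at this
        nlinarith [pow_pos hε 2]) t (right_mem_Icc.2 ht)
    exact (sq_le_sq₀ (norm_nonneg _) hε.le).1 this
  refine ⟨hp, fun ε hε => ⟨min (ε / 2) ρ, by positivity, fun φ hφ =>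
    hF.theSolution_iff.2 fun u hu t ht => ?_⟩, ρ, hρ, fun φ hφ => hF.mem_basin_iff.2
    fun u hu => ?_⟩
  · rw [mem_ball_iff_norm] at hφ ⊢
    have := key hu (by positivity) (min_le_right (ε / 2) ρ) hφ.le t ht
    linarith [min_le_left (ε / 2) ρ]
  · rw [mem_ball_iff_norm] at hφ
    have hb := key hu hρ le_rfl hφ.le
    have hexp : ∀ t, 0 ≤ t → ‖u t - p‖ ^ 2 ≤ ‖φ - p‖ ^ 2 * Real.exp (-(2 * k) * t) := by
      intro t ht
      have := le_mul_exp_of_deriv_le (k := -(2 * k)) ht (hD hu) fun s hs => by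
        have := h _ (hb s hs.1)
        linarith
      simpa [hu.1] using this
    have hlim : Tendsto (fun t => ‖φ - p‖ ^ 2 * Real.exp (-(2 * k) * t)) atTop (𝓝 0) := by
      have := (Real.tendsto_exp_atBot.comp
        (tendsto_id.const_mul_atTop_of_neg (show -(2 * k) < 0 by linarith))).const_mul
          (‖φ - p‖ ^ 2)
      simpa using! this
    have h2 : Tendsto (fun t => ‖u t - p‖ ^ 2) atTop (𝓝 0) :=
      squeeze_zero' (Eventually.of_forall fun t => sq_nonneg _)
        ((eventually_ge_atTop 0).mono hexp) hlim
    rw [tendsto_iff_norm_sub_tendsto_zero]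
    have := h2.sqrt
    simpa [Real.sqrt_sq (norm_nonneg _)] using! this

end Flow

/-! ### Gradient systems -/

section GradientFlow

open scoped RealInnerProductSpace

variable {X : Type*} [NormedAddCommGroup X] [InnerProductSpace ℝ X] [FiniteDimensional ℝ X]
  {F : X → X}

/-- Along bounded solutions of a gradient system the vector field tends to zero. -/
theorem IsDissipative.tendsto_field_of_gradient (hF : IsDissipative F) {W : X → ℝ}
    (hW : ∀ x, HasFDerivAt W (innerSL ℝ (F x)) x) {φ : X} {u : ℝ → X} (hu : IsSolution F φ u) :
    Tendsto (fun t => F (u t)) atTop (𝓝 0) := by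
  obtain ⟨M, hφM, hM0, hM⟩ := hF.exists_bound ‖φ‖
  have huM : ∀ t, 0 ≤ t → u t ∈ Metric.closedBall (0 : X) M := fun t ht => by
    simpa using hu.norm_le hφM hM ht
  obtain ⟨K, hK⟩ := hF.exists_lipschitzOnWith M
  obtain ⟨C, hC⟩ := (isCompact_closedBall (0 : X) M).exists_bound_of_continuousOn
    hF.contDiff.continuous.continuousOn
  have hC0 : 0 ≤ C := (norm_nonneg _).trans (hC 0 (by simpa using hM0.le))
  have hWc : Continuous W := continuous_iff_continuousAt.2 fun x => (hW x).continuousAt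
  obtain ⟨B, hB⟩ := (isCompact_closedBall (0 : X) M).exists_bound_of_continuousOn hWc.continuousOn
  have hder : ∀ {a b : ℝ}, 0 ≤ a → ∀ t ∈ Icc a b,
      HasDerivWithinAt (fun t => W (u t)) (‖F (u t)‖ ^ 2) (Icc a b) t := fun ha t ht => by
    have := (hW (u t)).comp_hasDerivWithinAt t (hu.hasDerivWithinAt_Icc ha t ht)
    simpa [real_inner_self_eq_norm_sq] using! this
  have hmono : ∀ s t, 0 ≤ s → s ≤ t → W (u s) ≤ W (u t) := fun s t hs hst => by
    have := mul_sub_le_of_le_deriv (m := 0) hst (hder hs) fun t _ => sq_nonneg _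
    linarith
  have hbdd : BddAbove ((fun t => W (u t)) '' Ici 0) := by
    refine ⟨B, ?_⟩
    rintro _ ⟨t, ht, rfl⟩
    exact (le_abs_self _).trans (hB _ (huM t ht))
  rw [Metric.tendsto_nhds]
  intro ε hε
  -- In time `τ` the solution moves at most `Cτ`, so the field changes by at most `KCτ ≤ ε / 2`. If
  -- its norm is at least `ε` at time `t`, the potential therefore grows by at least `(ε / 2)² τ` on
  -- `[t, t + τ]`; the `+ 1` keeps the denominator positive.
  set τ := ε / (2 * (K * C + 1)) with hτ
  have hτ0 : 0 < τ := by positivity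
  have hKτ : K * C * τ ≤ ε / 2 := by
    rw [hτ, ← mul_div_assoc, div_le_div_iff₀ (by positivity) two_pos]
    nlinarith
  -- From `t₀` on, the monotone potential is too close to its supremum to allow such a growth.
  obtain ⟨_, ⟨t₀, ht₀, rfl⟩, hlt⟩ := exists_lt_of_lt_csSup (Set.image_nonempty.2 nonempty_Ici)
    (sub_lt_self (sSup ((fun t => W (u t)) '' Ici 0))
      (show (0 : ℝ) < (ε / 2) ^ 2 * τ by positivity))
  filter_upwards [eventually_ge_atTop t₀] with t ht
  have ht0 : 0 ≤ t := le_trans ht₀ ht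
  rw [dist_zero_right]
  by_contra! hge
  have hlow : ∀ s ∈ Icc t (t + τ), (ε / 2) ^ 2 ≤ ‖F (u s)‖ ^ 2 := by
    intro s hs
    have h1 := norm_image_sub_le_of_norm_deriv_le_segment' (hu.hasDerivWithinAt_Icc ht0)
      (fun r hr => hC _ (huM r (ht0.trans hr.1))) s hs
    have h2 := hK.norm_sub_le (huM s (ht0.trans hs.1)) (huM t ht0)
    have h3 : ‖F (u s) - F (u t)‖ ≤ K * (C * τ) := h2.trans <| by
      gcongr
      exact h1.trans (by gcongr; linarith [hs.2])
    have h4 := norm_sub_norm_le (F (u t)) (F (u s))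
    rw [norm_sub_rev] at h4
    exact pow_le_pow_left₀ (by positivity) (by linarith) 2
  have h1 := mul_sub_le_of_le_deriv (by linarith) (hder ht0) hlow
  have h2 : W (u (t + τ)) ≤ sSup ((fun t => W (u t)) '' Ici 0) :=
    le_csSup hbdd ⟨t + τ, by simp; linarith, rfl⟩
  have h3 := hmono t₀ t ht₀ ht
  rw [add_sub_cancel_left] at h1
  linarith

end GradientFlow

/-! ### Dimension of the stable set -/

section StableSet

open scoped RealInnerProductSpace

variable {X : Type*} [NormedAddCommGroup X] [InnerProductSpace ℝ X] [FiniteDimensional ℝ X]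
  {F : X → X}

/-- If near `0` differences of solutions cannot leave the cone `⟪J w, w⟫ ≥ 0` and the projection `π`
is injective, with a quantitative bound, on the complementary cone, then the stable set of `0` has
at most the dimension of the target of `π`. -/
theorem IsDissipative.dimH_basin_zero_le (hF : IsDissipative F)
    {Y : Type*} [NormedAddCommGroup Y] [NormedSpace ℝ Y] [FiniteDimensional ℝ Y]
    (J : X →L[ℝ] X) (hJ : ∀ x y, ⟪J x, y⟫ = ⟪x, J y⟫) (π : X →L[ℝ] Y) {C η : ℝ} (hη : 0 < η)
    (hC : 0 ≤ C) (hπ : ∀ w, ⟪J w, w⟫ ≤ 0 → ‖w‖ ≤ C * ‖π w‖)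
    (hcone : ∀ x ∈ Metric.closedBall (0 : X) η, ∀ y ∈ Metric.closedBall (0 : X) η,
      0 ≤ ⟪J (x - y), F x - F y⟫) :
    dimH (basin F 0) ≤ Module.finrank ℝ Y := by
  choose sol hsol using hF.exists_solution
  -- A countable exhaustion of the basin with uniform bounds: solutions in `S n` start in the ball
  -- of radius `n` and stay `η`-close to `0` from time `n` on.
  let S : ℕ → Set X := fun n =>
    {φ | φ ∈ basin F 0 ∧ ‖φ‖ ≤ n ∧ ∀ t, (n : ℝ) ≤ t → ‖sol φ t‖ ≤ η}
  have hcover : basin F 0 ⊆ ⋃ n, S n := by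
    intro φ hφ
    have h1 := (hφ.2 _ (hsol φ)).norm
    rw [norm_zero] at h1
    obtain ⟨T, hT⟩ := eventually_atTop.1 (h1.eventually_le_const hη)
    obtain ⟨n, hn⟩ := exists_nat_ge (max T ‖φ‖)
    exact mem_iUnion.2 ⟨n, hφ, (le_max_right _ _).trans hn,
      fun t ht => hT t (((le_max_left _ _).trans hn).trans ht)⟩
  refine (dimH_mono hcover).trans ?_
  rw [dimH_iUnion]
  refine iSup_le fun n => ?_
  obtain ⟨M, hnM, hM0, hM⟩ := hF.exists_bound (n : ℝ)
  obtain ⟨K, hK⟩ := hF.exists_lipschitzOnWith M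
  have hn0 : (0 : ℝ) ≤ n := n.cast_nonneg
  have hin : ∀ φ ∈ S n, ∀ t ∈ Icc (0 : ℝ) n, sol φ t ∈ Metric.closedBall (0 : X) M :=
    fun φ hφ t ht => by simpa using (hsol φ).norm_le (hφ.2.1.trans hnM) hM ht.1
  set E := Real.exp (K * n) with hE
  have hE0 : 0 < E := Real.exp_pos _
  have hback : ∀ φ ∈ S n, ∀ ψ ∈ S n, ‖φ - ψ‖ ≤ E * ‖sol φ n - sol ψ n‖ := by
    intro φ hφ ψ hψ
    have := le_norm_sub_sq_of_lipschitzOnWith hK hn0 ((hsol φ).hasDerivWithinAt_Icc le_rfl)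
      ((hsol ψ).hasDerivWithinAt_Icc le_rfl) (hin φ hφ) (hin ψ hψ)
    rw [(hsol φ).1, (hsol ψ).1, show -2 * (K : ℝ) * (n - 0) = -(K * n + K * n) by ring, Real.exp_neg,
      Real.exp_add, ← hE, ← div_eq_mul_inv, div_le_iff₀ (by positivity)] at this
    refine (sq_le_sq₀ (norm_nonneg _) (by positivity)).1 ?_
    linarith
  -- By the cone condition the form is nondecreasing along differences after time `n`. A positive
  -- value could not decay to `0`, although both solutions tend to `0`.
  have hnonpos : ∀ φ ∈ S n, ∀ ψ ∈ S n,
      ⟪J (sol φ n - sol ψ n), sol φ n - sol ψ n⟫ ≤ 0 := by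
    intro φ hφ ψ hψ
    by_contra! hpos
    have hd : ∀ b, ∀ t ∈ Icc (n : ℝ) b,
        HasDerivWithinAt (fun t => ⟪J (sol φ t - sol ψ t), sol φ t - sol ψ t⟫)
          (2 * ⟪J (sol φ t - sol ψ t), F (sol φ t) - F (sol ψ t)⟫) (Icc (n : ℝ) b) t := by
      intro b t ht
      have h1 := ((hsol φ).hasDerivWithinAt_Icc hn0 t ht).sub
        ((hsol ψ).hasDerivWithinAt_Icc hn0 t ht)
      have h2 := (J.hasFDerivAt.comp_hasDerivWithinAt t h1).inner ℝ h1
      convert! h2 using 1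
      simp only [Function.comp_apply, Pi.sub_apply]
      rw [hJ (F (sol φ t) - F (sol ψ t)), real_inner_comm]
      ring
    have hge : ∀ t, (n : ℝ) ≤ t → ⟪J (sol φ n - sol ψ n), sol φ n - sol ψ n⟫ ≤
        ⟪J (sol φ t - sol ψ t), sol φ t - sol ψ t⟫ := by
      intro t ht
      have := mul_sub_le_of_le_deriv (m := 0) ht (hd t) fun s hs => by
        have := hcone (sol φ s) (by simpa using hφ.2.2 s hs.1) (sol ψ s)
          (by simpa using hψ.2.2 s hs.1)
        linarith
      linarith
    have hlim : Tendsto (fun t => ⟪J (sol φ t - sol ψ t), sol φ t - sol ψ t⟫) atTop (𝓝 0) := by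
      have h1 := (hφ.1.2 _ (hsol φ)).sub (hψ.1.2 _ (hsol ψ))
      rw [sub_zero] at h1
      have h2 := ((J.continuous.tendsto 0).comp h1).inner (𝕜 := ℝ) h1
      simpa using h2
    exact absurd (ge_of_tendsto hlim ((eventually_ge_atTop _).mono hge)) (not_le.2 hpos)
  -- Flowing to time `n` and then projecting is antilipschitz on `S n`, so it cannot lower the
  -- Hausdorff dimension.
  let f : X → Y := fun φ => π (sol φ n)
  have hf : ∀ φ ∈ S n, ∀ ψ ∈ S n, ‖φ - ψ‖ ≤ E * C * ‖f φ - f ψ‖ := by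
    intro φ hφ ψ hψ
    have h1 := hπ _ (hnonpos φ hφ ψ hψ)
    rw [map_sub] at h1
    calc ‖φ - ψ‖ ≤ E * ‖sol φ n - sol ψ n‖ := hback φ hφ ψ hψ
      _ ≤ E * (C * ‖π (sol φ n) - π (sol ψ n)‖) := by gcongr
      _ = _ := by ring
  have hanti : AntilipschitzWith ⟨E * C, by positivity⟩ ((S n).domRestrict f) :=
    AntilipschitzWith.of_le_mul_dist fun x y => by
      rw [Subtype.dist_eq, dist_eq_norm, dist_eq_norm]
      exact hf x x.2 y y.2
  calc dimH (S n) = dimH (Subtype.val '' (univ : Set (S n))) := by simp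
    _ = dimH (univ : Set (S n)) := isometry_subtype_coe.dimH_image _
    _ ≤ dimH ((S n).domRestrict f '' univ) := hanti.le_dimH_image _
    _ ≤ dimH (univ : Set Y) := dimH_mono (subset_univ _)
    _ = _ := Real.dimH_univ_eq_finrank Y

end StableSet

/-! ### Restriction to an invariant subspace -/

section InvariantSubspace

open scoped RealInnerProductSpace

variable {X : Type*} [NormedAddCommGroup X] [InnerProductSpace ℝ X] [FiniteDimensional ℝ X]
  {F : X → X} {S : Submodule ℝ X}

theorem IsDissipative.restrict (hF : IsDissipative F) :
    IsDissipative (fun x : S => S.orthogonalProjectionOnto (F x)) := by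
  refine ⟨S.orthogonalProjectionOnto.contDiff.comp
    (hF.contDiff.comp S.subtypeL.contDiff), ?_⟩
  obtain ⟨R, hR⟩ := hF.inward
  refine ⟨R, fun x hx => ?_⟩
  rw [real_inner_comm, Submodule.inner_orthogonalProjectionOnto_eq_of_mem_right, real_inner_comm]
  exact hR x hx

theorem DynTransition.IsSolution.coe_restrict (hS : ∀ x ∈ S, F x ∈ S) {φ : S} {w : ℝ → S}
    (hw : IsSolution (fun x : S => S.orthogonalProjectionOnto (F x)) φ w) :
    IsSolution F φ (fun t => (w t : X)) := by
  refine ⟨by simp [hw.1], fun t ht => ?_⟩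
  have := S.subtypeL.hasFDerivAt.comp_hasDerivWithinAt t (hw.2 t ht)
  convert! this using 1
  exact (Submodule.starProjection_eq_self_iff.2 (hS _ (w t).2)).symm

/-- The restricted system has a solution of its own in `S`; by uniqueness it is the given one. -/
theorem IsDissipative.mem_of_isSolution (hF : IsDissipative F) (hS : ∀ x ∈ S, F x ∈ S) {φ : X}
    (hφ : φ ∈ S) {u : ℝ → X} (hu : IsSolution F φ u) {t : ℝ} (ht : 0 ≤ t) : u t ∈ S := by
  obtain ⟨w, hw⟩ := (hF.restrict (S := S)).exists_solution ⟨φ, hφ⟩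
  rw [hF.unique hu (hw.coe_restrict hS) ht]
  exact (w t).2

theorem IsDissipative.theSolution_restrict (hF : IsDissipative F) (hS : ∀ x ∈ S, F x ∈ S) {φ : S}
    {Q : (ℝ → X) → Prop} (h : TheSolution F φ Q) :
    TheSolution (fun x : S => S.orthogonalProjectionOnto (F x)) φ fun w => Q fun t => (w t : X) :=
  ⟨hF.restrict.exists_solution φ, fun _ hw => h.2 _ (hw.coe_restrict hS)⟩

theorem IsDissipative.basin_restrict (hF : IsDissipative F) (hS : ∀ x ∈ S, F x ∈ S) (p : S) :
    basin (fun x : S => S.orthogonalProjectionOnto (F x)) p = Subtype.val ⁻¹' basin F (p : X) := by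
  ext φ
  constructor
  · rintro ⟨⟨w, hw⟩, h⟩
    exact hF.mem_basin_of_solution (hw.coe_restrict hS)
      ((continuous_subtype_val.tendsto p).comp (h w hw))
  · intro h
    have := hF.theSolution_restrict hS h
    exact ⟨this.1, fun w hw => tendsto_subtype_rng.2 (this.2 w hw)⟩

theorem IsDissipative.isAsymptoticallyStable_restrict (hF : IsDissipative F)
    (hS : ∀ x ∈ S, F x ∈ S) {p : S} (h : IsAsymptoticallyStable F (p : X)) :
    IsAsymptoticallyStable (fun x : S => S.orthogonalProjectionOnto (F x)) p := by
  refine ⟨?_, fun ε hε => ?_, ?_⟩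
  · simp [h.1]
  · obtain ⟨δ, hδ, hd⟩ := h.2.1 ε hε
    exact ⟨δ, hδ, fun φ hφ => hF.theSolution_restrict hS (hd φ hφ)⟩
  · obtain ⟨δ, hδ, hd⟩ := h.2.2
    refine ⟨δ, hδ, fun φ hφ => ?_⟩
    rw [hF.basin_restrict hS]
    exact hd hφ

end InvariantSubspace

/-! ### Bounds for the limsup of the norm -/

section LimsupNorm

variable {X : Type*} [NormedAddCommGroup X]

theorem limsupNorm_le_of_forall {u : ℝ → X} {ρ : ℝ} (hρ : 0 ≤ ρ)
    (h : ∀ ε : ℝ, 0 < ε → ∀ᶠ t in atTop, ‖u t‖ ≤ ρ + ε) : limsupNorm u ≤ ENNReal.ofReal ρ := by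
  refine ENNReal.le_of_forall_pos_le_add fun ε hε _ => ?_
  rw [← ENNReal.ofReal_coe_nnreal (p := ε), ← ENNReal.ofReal_add hρ ε.coe_nonneg]
  refine limsup_le_of_le (by isBoundedDefault) ?_
  filter_upwards [h ε hε] with t ht
  rw [← ofReal_norm]
  exact ENNReal.ofReal_le_ofReal ht

theorem limsupNorm_eq_of_tendsto {u : ℝ → X} {p : X} (h : Tendsto u atTop (𝓝 p)) :
    limsupNorm u = ‖p‖ₑ := h.enorm.limsup_eq

theorem eventually_norm_lt_of_limsupNorm_lt {u : ℝ → X} {δ : ℝ}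
    (h : limsupNorm u < ENNReal.ofReal δ) : ∀ᶠ t in atTop, ‖u t‖ < δ := by
  filter_upwards [eventually_lt_of_limsup_lt h (by isBoundedDefault)] with t ht
  rw [← ofReal_norm] at ht
  exact (ENNReal.ofReal_lt_ofReal_iff_of_nonneg (norm_nonneg _)).1 ht

end LimsupNorm

/-- The shifted field with coefficients `b = β₁`, `c = β₂`, `a = a₂` and `α = α₄`. -/
noncomputable def glField (b c a α : ℝ) (M : Magnetization) : Magnetization :=
  !₂[b * M 0 - 2 * a * M 0 ^ 2 - a * ‖M‖ ^ 2 - α * ‖M‖ ^ 2 * M 0,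
     c * M 1 - 2 * a * M 0 * M 1 - α * ‖M‖ ^ 2 * M 1,
     c * M 2 - 2 * a * M 0 * M 2 - α * ‖M‖ ^ 2 * M 2]

/-- The field `glField` on the axis. -/
def axisField (b a α x : ℝ) : ℝ := b * x - 3 * a * x ^ 2 - α * x ^ 3

open scoped RealInnerProductSpace
open Ferromagnet (onAxis axis)

theorem Ferromagnet.shiftedField_eq_glField (P : Ferromagnet) (T : ℝ) :
    P.shiftedField T = glField (P.β₁ T) (P.β₂ T) (P.a₂ T) (P.α₄ T) := rfl

/-! ### The Ginzburg–Landau field: gradient structure and attraction to the axis -/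

section Field

variable {b c a α : ℝ}

theorem norm_sq_eq_coords (M : Magnetization) : ‖M‖ ^ 2 = M 0 ^ 2 + M 1 ^ 2 + M 2 ^ 2 := by
  simp [EuclideanSpace.norm_sq_eq, Fin.sum_univ_three]

theorem abs_coord_le_norm (M : Magnetization) (i : Fin 3) : |M i| ≤ ‖M‖ := PiLp.norm_apply_le M i

theorem inner_eq_coords (M N : Magnetization) :
    ⟪M, N⟫ = M 0 * N 0 + M 1 * N 1 + M 2 * N 2 := by
  simp [PiLp.inner_apply, Fin.sum_univ_three, mul_comm]

theorem onAxis_zero : onAxis 0 = 0 := by ext i; fin_cases i <;> simp [onAxis]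

theorem onAxis_injective : Function.Injective onAxis := fun x y h => by
  simpa [onAxis] using congrArg (fun M : Magnetization => M 0) h

theorem continuous_onAxis : Continuous onAxis := by
  unfold Ferromagnet.onAxis
  refine (PiLp.continuous_toLp 2 _).comp (continuous_pi fun i => ?_)
  fin_cases i <;> simp <;> fun_prop

theorem norm_onAxis (x : ℝ) : ‖onAxis x‖ = |x| := by
  rw [← sq_eq_sq₀ (norm_nonneg _) (abs_nonneg _), norm_sq_eq_coords, sq_abs]
  simp [onAxis]

theorem neg_onAxis (x : ℝ) : -onAxis x = onAxis (-x) := by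
  ext i; fin_cases i <;> simp [onAxis]

theorem mem_axis_iff {M : Magnetization} : M ∈ axis ↔ M 1 = 0 ∧ M 2 = 0 := by
  rw [Ferromagnet.axis, Submodule.mem_span_singleton]
  constructor
  · rintro ⟨x, rfl⟩
    simp [onAxis]
  · rintro ⟨h1, h2⟩
    exact ⟨M 0, by ext i; fin_cases i <;> simp [onAxis, h1, h2]⟩

theorem onAxis_mem_axis (x : ℝ) : onAxis x ∈ axis := mem_axis_iff.2 (by simp [onAxis])

theorem eq_onAxis {M : Magnetization} (h1 : M 1 = 0) (h2 : M 2 = 0) : M = onAxis (M 0) := by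
  ext i; fin_cases i <;> simp [onAxis, h1, h2]

theorem glField_mem_axis {M : Magnetization} (hM : M ∈ axis) : glField b c a α M ∈ axis := by
  rw [mem_axis_iff] at hM ⊢
  simp [glField, hM.1, hM.2]

theorem glField_eq (M : Magnetization) : glField b c a α M =
    c • M + ((b - c) * M 0) • onAxis 1 - (2 * a * M 0) • M
      - ‖M‖ ^ 2 • (a • onAxis 1 + α • M) := by
  ext i; fin_cases i <;> simp [glField, onAxis] <;> ring

/-- This reflection reduces negative `a` to positive `a` and the left outer root to the right one.
-/
theorem glField_neg (M : Magnetization) : glField b c (-a) α (-M) = -glField b c a α M := by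
  ext i; fin_cases i <;> simp [glField] <;> ring

theorem glField_onAxis (x : ℝ) : glField b c a α (onAxis x) = onAxis (axisField b a α x) := by
  have h : ‖onAxis x‖ ^ 2 = x ^ 2 := by rw [norm_onAxis, sq_abs]
  ext i; fin_cases i <;> simp [glField, h, axisField]
  · simp [onAxis]; ring
  · simp [onAxis]
  · simp [onAxis]

theorem contDiff_glField : ContDiff ℝ 1 (glField b c a α) := by
  have h : ContDiff ℝ 1 fun M : Magnetization => M 0 :=
    (EuclideanSpace.proj (𝕜 := ℝ) (0 : Fin 3)).contDiff
  have h2 : ContDiff ℝ 1 fun M : Magnetization => ‖M‖ ^ 2 := contDiff_norm_sq ℝ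
  rw [show glField b c a α = _ from funext glField_eq]
  fun_prop

theorem inner_glField (M : Magnetization) : ⟪M, glField b c a α M⟫ =
    b * M 0 ^ 2 + c * (‖M‖ ^ 2 - M 0 ^ 2) - 3 * a * M 0 * ‖M‖ ^ 2 - α * (‖M‖ ^ 2) ^ 2 := by
  rw [inner_eq_coords]
  have := norm_sq_eq_coords M
  simp [glField]
  linear_combination (-c + 2 * a * M 0 + α * ‖M‖ ^ 2) * this

theorem glField_isDissipative (hα : 0 < α) : IsDissipative (glField b c a α) := by
  -- Beyond this radius `n ≥ 1`, so all lower-order terms are at most `(|b| + |c| + 3|a|) n³`, while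
  -- `α n ≥ α + |b| + |c| + 3|a|`. The quartic term wins by `α n³`.
  refine ⟨contDiff_glField, 1 + (|b| + |c| + 3 * |a|) / α, fun M hM => ?_⟩
  rw [inner_glField]
  have h0 := abs_coord_le_norm M 0
  set n := ‖M‖
  set x := M 0
  have hpos : 0 ≤ (|b| + |c| + 3 * |a|) / α := by positivity
  have hn1 : 1 ≤ n := by linarith
  have hx2 : x ^ 2 ≤ n ^ 2 := sq_le_sq' (by linarith [neg_abs_le x]) ((le_abs_self x).trans h0)
  have hn : α + (|b| + |c| + 3 * |a|) ≤ α * n := by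
    have := mul_le_mul_of_nonneg_left hM hα.le
    rwa [mul_add, mul_div_cancel₀ _ hα.ne', mul_one] at this
  have e1 : b * x ^ 2 ≤ |b| * n ^ 2 :=
    (mul_le_mul_of_nonneg_right (le_abs_self b) (sq_nonneg x)).trans (by gcongr)
  have e2 : c * (n ^ 2 - x ^ 2) ≤ |c| * n ^ 2 :=
    (mul_le_mul_of_nonneg_right (le_abs_self c) (by linarith)).trans
      (by gcongr; linarith [sq_nonneg x])
  have e3 : -(3 * a * x * n ^ 2) ≤ 3 * |a| * n ^ 3 := by
    have : -(a * x) ≤ |a| * n := (neg_le_abs _).trans (by rw [abs_mul]; gcongr)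
    nlinarith [mul_le_mul_of_nonneg_right this (sq_nonneg n)]
  have e4 : (|b| + |c| + 3 * |a|) * n ^ 3 + α * n ^ 3 ≤ α * n ^ 4 := by
    have := mul_le_mul_of_nonneg_right hn (pow_nonneg (zero_le_one.trans hn1) 3)
    linarith
  have e5 : (|b| + |c|) * n ^ 2 ≤ (|b| + |c|) * n ^ 3 := by
    gcongr
    norm_num
  have e6 : 0 < α * n ^ 3 := by positivity
  linarith

/-- The two quadratic terms of the field fit together: both come from the single cubic `-a * M 0 *
‖M‖ ^ 2`. -/
theorem hasFDerivAt_glPotential (M : Magnetization) :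
    HasFDerivAt (fun M : Magnetization => (c * ‖M‖ ^ 2 + (b - c) * M 0 ^ 2) / 2
      - a * M 0 * ‖M‖ ^ 2 - α * (‖M‖ ^ 2) ^ 2 / 4) (innerSL ℝ (glField b c a α M)) M := by
  have h0 : HasFDerivAt (fun M : Magnetization => M 0) (EuclideanSpace.proj (𝕜 := ℝ) 0) M :=
    (EuclideanSpace.proj (𝕜 := ℝ) (0 : Fin 3)).hasFDerivAt
  have h2 : HasFDerivAt (fun M : Magnetization => ‖M‖ ^ 2) (2 • innerSL ℝ M) M :=
    (hasStrictFDerivAt_norm_sq M).hasFDerivAt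
  have := ((((h2.const_mul c).add ((h0.pow 2).const_mul (b - c))).mul_const (1 / 2)).sub
    ((h0.const_mul a).mul h2)).sub ((h2.pow 2).const_mul (α / 4))
  convert! this using 1
  · ext M; simp; ring
  · ext N
    have hN := norm_sq_eq_coords M
    simp [inner_eq_coords, glField]
    ring

theorem tendsto_glField_of_isSolution (hα : 0 < α) {φ : Magnetization} {u : ℝ → Magnetization}
    (hu : IsSolution (glField b c a α) φ u) :
    Tendsto (fun t => glField b c a α (u t)) atTop (𝓝 0) :=
  (glField_isDissipative hα).tendsto_field_of_gradient hasFDerivAt_glPotential hu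

/-- Elimination of the first coordinate: the transverse coordinates are controlled by the field. -/
theorem abs_transverse_le (hα : 0 < α) (hcb : c < b) (M : Magnetization) (i : Fin 3)
    (hi : i ≠ 0) : α * (-c) * (b - c) * |M i| ≤
      (α * (b - c) + 2 * a ^ 2 + 2 * |a| * (2 * α * ‖M‖ + |a|)) * ‖glField b c a α M‖ := by
  set G := glField b c a α M with hG
  set D := α * (b - c) + 2 * a ^ 2 with hD
  have hD0 : 0 < D := by
    have := mul_pos hα (sub_pos.2 hcb)
    positivity
  have hGi : G i = c * M i - 2 * a * M 0 * M i - α * ‖M‖ ^ 2 * M i := by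
    fin_cases i
    · exact absurd rfl hi
    · rfl
    · rfl
  have hG0 : G 0 = b * M 0 - 2 * a * M 0 ^ 2 - a * ‖M‖ ^ 2 - α * ‖M‖ ^ 2 * M 0 := rfl
  -- The inner combination is `M i * (D * M 0 - a * c)`, since all its higher-order terms cancel.
  -- Adding `2a` times it to `D * G i` removes the remaining `M 0`, whose sign is unknown.
  have key : D * G i + 2 * a * (α * M i * G 0 - (α * M 0 + a) * G i) =
      -(M i * (α * (-c) * (b - c) + α * D * ‖M‖ ^ 2)) := by
    rw [hGi, hG0, hD]; ring
  have h1 : α * (-c) * (b - c) * |M i| ≤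
      |D * G i + 2 * a * (α * M i * G 0 - (α * M 0 + a) * G i)| := by
    rw [key, abs_neg, abs_mul, mul_comm]
    gcongr
    refine le_trans ?_ (le_abs_self _)
    have : 0 ≤ α * D * ‖M‖ ^ 2 := by positivity
    linarith
  have n0 := abs_coord_le_norm M 0
  have ni := abs_coord_le_norm M i
  have g0 := abs_coord_le_norm G 0
  have gi := abs_coord_le_norm G i
  refine h1.trans ((abs_add_le _ _).trans ?_)
  rw [abs_mul D, abs_of_pos hD0, abs_mul (2 * a), abs_mul 2 a, abs_two]
  have h2 : |α * M i * G 0 - (α * M 0 + a) * G i| ≤ (2 * α * ‖M‖ + |a|) * ‖G‖ := by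
    refine (abs_sub _ _).trans ?_
    rw [abs_mul, abs_mul, abs_mul, abs_of_pos hα]
    have h3 : |α * M 0 + a| ≤ α * ‖M‖ + |a| := by
      refine (abs_add_le _ _).trans ?_
      rw [abs_mul, abs_of_pos hα]
      gcongr
    calc α * |M i| * |G 0| + |α * M 0 + a| * |G i|
        ≤ α * ‖M‖ * ‖G‖ + (α * ‖M‖ + |a|) * ‖G‖ := by gcongr
      _ = _ := by ring
  calc D * |G i| + 2 * |a| * |α * M i * G 0 - (α * M 0 + a) * G i|
      ≤ D * ‖G‖ + 2 * |a| * ((2 * α * ‖M‖ + |a|) * ‖G‖) := by gcongr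
    _ = _ := by ring

/-- The field tends to zero along the bounded solution, and `abs_transverse_le` transfers this to
the transverse coordinates. The attraction to the axis is thus global. -/
theorem tendsto_transverse (hα : 0 < α) (hc : c < 0) (hcb : c < b) {φ : Magnetization}
    {u : ℝ → Magnetization} (hu : IsSolution (glField b c a α) φ u) (i : Fin 3) (hi : i ≠ 0) :
    Tendsto (fun t => u t i) atTop (𝓝 0) := by
  obtain ⟨R, hφR, hR0, hR⟩ := (glField_isDissipative (b := b) (c := c) (a := a) hα).exists_bound ‖φ‖
  have hk : 0 < α * (-c) * (b - c) := mul_pos (mul_pos hα (neg_pos.2 hc)) (sub_pos.2 hcb)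
  have hbound : ∀ᶠ t in atTop, ‖u t i‖ ≤
      (α * (b - c) + 2 * a ^ 2 + 2 * |a| * (2 * α * R + |a|)) / (α * (-c) * (b - c))
        * ‖glField b c a α (u t)‖ := by
    filter_upwards [eventually_ge_atTop 0] with t ht
    rw [div_mul_eq_mul_div, le_div_iff₀ hk, mul_comm, Real.norm_eq_abs]
    refine (abs_transverse_le (a := a) hα hcb (u t) i hi).trans ?_
    gcongr
    exact hu.norm_le hφR hR ht
  refine squeeze_zero_norm' hbound ?_
  simpa using (tendsto_glField_of_isSolution hα hu).norm.const_mul _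

theorem eq_onAxis_of_glField_eq_zero (hα : 0 < α) (hc : c < 0) (hcb : c < b) {M : Magnetization}
    (hM : glField b c a α M = 0) : M = onAxis (M 0) ∧ axisField b a α (M 0) = 0 := by
  have h : ∀ i : Fin 3, i ≠ 0 → M i = 0 := fun i hi => by
    have h1 := abs_transverse_le (a := a) hα hcb M i hi
    rw [hM, norm_zero, mul_zero] at h1
    have hk : 0 < α * (-c) * (b - c) := mul_pos (mul_pos hα (neg_pos.2 hc)) (sub_pos.2 hcb)
    have h2 : |M i| ≤ 0 := by
      by_contra! h
      nlinarith
    exact abs_eq_zero.1 (le_antisymm h2 (abs_nonneg _))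
  have h1 := eq_onAxis (h 1 (by decide)) (h 2 (by decide))
  refine ⟨h1, ?_⟩
  rw [h1, glField_onAxis, ← onAxis_zero] at hM
  exact onAxis_injective hM

/-- The first component of the field differs from the cubic only by `(a + α x)` times the squared
distance to the axis. -/
theorem tendsto_axisField {u : ℝ → Magnetization} {R : ℝ} (hR : ∀ᶠ t in atTop, ‖u t‖ ≤ R)
    (hF : Tendsto (fun t => glField b c a α (u t)) atTop (𝓝 0))
    (h1 : Tendsto (fun t => u t 1) atTop (𝓝 0)) (h2 : Tendsto (fun t => u t 2) atTop (𝓝 0)) :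
    Tendsto (fun t => axisField b a α (u t 0)) atTop (𝓝 0) := by
  have hF0 : Tendsto (fun t => glField b c a α (u t) 0) atTop (𝓝 0) := by
    simpa using! ((EuclideanSpace.proj (𝕜 := ℝ) (0 : Fin 3)).continuous.tendsto 0).comp hF
  have hr : Tendsto (fun t => u t 1 ^ 2 + u t 2 ^ 2) atTop (𝓝 0) := by
    simpa using (h1.pow 2).add (h2.pow 2)
  have hprod : Tendsto (fun t => (a + α * u t 0) * (u t 1 ^ 2 + u t 2 ^ 2)) atTop (𝓝 0) := by
    refine squeeze_zero_norm' (a := fun t => (|a| + |α| * R) * (u t 1 ^ 2 + u t 2 ^ 2)) ?_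
      (by simpa using hr.const_mul (|a| + |α| * R))
    filter_upwards [hR] with t ht
    rw [norm_mul, Real.norm_eq_abs, Real.norm_eq_abs, abs_of_nonneg (by positivity : 0 ≤ u t 1 ^ 2 + u t 2 ^ 2)]
    gcongr
    refine (abs_add_le _ _).trans ?_
    rw [abs_mul]
    gcongr
    exact (abs_coord_le_norm _ 0).trans ht
  have := hF0.add hprod
  rw [add_zero] at this
  refine this.congr fun t => ?_
  have := norm_sq_eq_coords (u t)
  simp [glField, axisField]
  linear_combination (-a - α * u t 0) * this

theorem tendsto_onAxis {u : ℝ → Magnetization} {x : ℝ}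
    (h0 : Tendsto (fun t => u t 0) atTop (𝓝 x)) (h1 : Tendsto (fun t => u t 1) atTop (𝓝 0))
    (h2 : Tendsto (fun t => u t 2) atTop (𝓝 0)) : Tendsto u atTop (𝓝 (onAxis x)) := by
  have h : Tendsto (fun t => (u t).ofLp) atTop (𝓝 ![x, 0, 0]) := by
    rw [tendsto_pi_nhds]
    intro i
    fin_cases i
    exacts [h0, h1, h2]
  exact ((PiLp.continuous_toLp 2 _).tendsto _).comp h

/-- The two negative quantities are the axial and the transverse eigenvalue of the linearization.
The squared distance to the equilibrium is a Lyapunov function. -/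
theorem isAsymptoticallyStable_glField (hα : 0 < α) {p : ℝ} (hp : axisField b a α p = 0)
    (hd : b - 6 * a * p - 3 * α * p ^ 2 < 0) (ht : c - 2 * a * p - α * p ^ 2 < 0) :
    IsAsymptoticallyStable (glField b c a α) (onAxis p) := by
  obtain ⟨k, hk, hkd, hkt⟩ : ∃ k, 0 < k ∧ b - 6 * a * p - 3 * α * p ^ 2 ≤ -2 * k ∧
      c - 2 * a * p - α * p ^ 2 ≤ -2 * k := by
    refine ⟨min (-(b - 6 * a * p - 3 * α * p ^ 2)) (-(c - 2 * a * p - α * p ^ 2)) / 2, ?_, ?_, ?_⟩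
    · exact half_pos (lt_min (neg_pos.2 hd) (neg_pos.2 ht))
    · linarith [min_le_left (-(b - 6 * a * p - 3 * α * p ^ 2)) (-(c - 2 * a * p - α * p ^ 2))]
    · linarith [min_le_right (-(b - 6 * a * p - 3 * α * p ^ 2)) (-(c - 2 * a * p - α * p ^ 2))]
  -- Both eigenvalues are at most `-2k`. On a ball of radius `ρ` the cubic term costs at most `3|a +
  -- αp|ρ ≤ k` times the squared distance, which leaves the rate `k`; the quartic term has the good
  -- sign.
  refine (glField_isDissipative hα).isAsymptoticallyStable_of_inner_le (k := k)
    (ρ := k / (3 * |a + α * p| + 1)) (by rw [glField_onAxis, hp, onAxis_zero]) hk (by positivity)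
    fun M hM => ?_
  rw [le_div_iff₀ (by positivity)] at hM
  have hx := abs_coord_le_norm (M - onAxis p) 0
  have hN := norm_sq_eq_coords (M - onAxis p)
  have hM2 := norm_sq_eq_coords M
  have hexp : ⟪M - onAxis p, glField b c a α M⟫ =
      (b - 6 * a * p - 3 * α * p ^ 2) * (M - onAxis p) 0 ^ 2
      + (c - 2 * a * p - α * p ^ 2) * ((M - onAxis p) 1 ^ 2 + (M - onAxis p) 2 ^ 2)
      - 3 * (a + α * p) * (M - onAxis p) 0 * ‖M - onAxis p‖ ^ 2
      - α * (‖M - onAxis p‖ ^ 2) ^ 2 := by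
    rw [inner_eq_coords, hN]
    simp only [glField, hM2, axisField] at hp ⊢
    simp [onAxis]
    linear_combination (M 0 - p) * hp
  rw [hexp]
  set n := ‖M - onAxis p‖
  have hn : 0 ≤ n := norm_nonneg _
  have e1 : -(3 * (a + α * p) * (M - onAxis p) 0) ≤ k := by
    have : -((a + α * p) * (M - onAxis p) 0) ≤ |a + α * p| * n :=
      (neg_le_abs _).trans (by rw [abs_mul]; gcongr)
    nlinarith
  have e2 := mul_le_mul_of_nonneg_right e1 (sq_nonneg n)
  have e3 := mul_le_mul_of_nonneg_right hkd (sq_nonneg ((M - onAxis p) 0))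
  have e4 := mul_le_mul_of_nonneg_right hkt
    (add_nonneg (sq_nonneg ((M - onAxis p) 1)) (sq_nonneg ((M - onAxis p) 2)))
  have e5 : 0 ≤ α * (n ^ 2) ^ 2 := by positivity
  have e6 : -2 * k * n ^ 2 = -2 * k * (M - onAxis p) 0 ^ 2
    + -2 * k * ((M - onAxis p) 1 ^ 2 + (M - onAxis p) 2 ^ 2) := by rw [hN]; ring
  linarith

end Field

/-- The field on the axis has the three real zeros `p < q < s`, one of which is `0`. -/
structure AxisRoots (b a α p q s : ℝ) : Prop where
  lt_left : p < q
  lt_right : q < s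
  sum : 3 * a = -α * (p + q + s)
  pairs : b = -α * (p * q + p * s + q * s)
  prod : p * q * s = 0

/-! ### Dynamics in terms of the three roots of the cubic -/

section Dynamics

variable {b c a α p q s : ℝ}

theorem AxisRoots.axisField_eq (h : AxisRoots b a α p q s) (x : ℝ) :
    axisField b a α x = -α * ((x - p) * (x - q) * (x - s)) := by
  rw [axisField]
  linear_combination x * h.pairs - x ^ 2 * h.sum - α * h.prod

theorem AxisRoots.neg (h : AxisRoots b a α p q s) : AxisRoots b (-a) α (-s) (-q) (-p) where
  lt_left := neg_lt_neg h.lt_right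
  lt_right := neg_lt_neg h.lt_left
  sum := by linear_combination -h.sum
  pairs := by linear_combination h.pairs
  prod := by linear_combination -h.prod

theorem DynTransition.IsSolution.glField_neg {φ : Magnetization} {u : ℝ → Magnetization}
    (hu : IsSolution (glField b c a α) φ u) :
    IsSolution (glField b c (-a) α) (-φ) (fun t => -u t) :=
  ⟨by simp [hu.1], fun t ht => by rw [_root_.glField_neg]; exact (hu.2 t ht).neg⟩

/-- Right of `m > q` the factors belonging to `p` and `q` are bounded below, so a small value of the
cubic means a small distance to `s`. -/
theorem AxisRoots.tendsto_upper (h : AxisRoots b a α p q s) (hα : 0 < α)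
    {u : ℝ → Magnetization} {m : ℝ} (hm : q < m) (hev : ∀ᶠ t in atTop, m ≤ u t 0)
    (hf : Tendsto (fun t => axisField b a α (u t 0)) atTop (𝓝 0))
    (h1 : Tendsto (fun t => u t 1) atTop (𝓝 0)) (h2 : Tendsto (fun t => u t 2) atTop (𝓝 0)) :
    Tendsto u atTop (𝓝 (onAxis s)) := by
  refine tendsto_onAxis ?_ h1 h2
  have hk : 0 < α * ((m - p) * (m - q)) :=
    mul_pos hα (mul_pos (sub_pos.2 (h.lt_left.trans hm)) (sub_pos.2 hm))
  rw [tendsto_iff_norm_sub_tendsto_zero]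
  have hlim := hf.norm.const_mul (α * ((m - p) * (m - q)))⁻¹
  rw [norm_zero, mul_zero] at hlim
  refine squeeze_zero' (Eventually.of_forall fun t => norm_nonneg _) ?_ hlim
  filter_upwards [hev] with t ht
  have hp := h.lt_left
  have e : α * ((m - p) * (m - q)) ≤ α * ((u t 0 - p) * (u t 0 - q)) := by
    gcongr
    linarith
  have hfac : ‖axisField b a α (u t 0)‖ =
      α * ((u t 0 - p) * (u t 0 - q)) * ‖u t 0 - s‖ := by
    rw [h.axisField_eq, neg_mul, norm_neg, ← mul_assoc, norm_mul,
      Real.norm_of_nonneg (hk.le.trans e)]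
  rw [inv_mul_eq_div, le_div_iff₀ hk, hfac, mul_comm]
  gcongr

theorem AxisRoots.tendsto_lower (h : AxisRoots b a α p q s) (hα : 0 < α)
    {u : ℝ → Magnetization} {m : ℝ} (hm : m < q) (hev : ∀ᶠ t in atTop, u t 0 ≤ m)
    (hf : Tendsto (fun t => axisField b a α (u t 0)) atTop (𝓝 0))
    (h1 : Tendsto (fun t => u t 1) atTop (𝓝 0)) (h2 : Tendsto (fun t => u t 2) atTop (𝓝 0)) :
    Tendsto u atTop (𝓝 (onAxis p)) := by
  have := h.neg.tendsto_upper hα (u := fun t => -u t) (m := -m) (neg_lt_neg hm)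
    (hev.mono fun t ht => neg_le_neg ht)
    (by convert! hf.neg using 1
        · ext t; simp [axisField]; ring
        · simp) (by simpa using! h1.neg) (by simpa using! h2.neg)
  rw [← neg_onAxis] at this
  simpa using this.neg

theorem hasDerivWithinAt_coord_zero {φ : Magnetization} {u : ℝ → Magnetization}
    (hu : IsSolution (glField b c a α) φ u) {t₀ t₁ t : ℝ} (h0 : 0 ≤ t₀) (ht : t ∈ Icc t₀ t₁) :
    HasDerivWithinAt (fun t => u t 0) (axisField b a α (u t 0)
      - (a + α * u t 0) * (u t 1 ^ 2 + u t 2 ^ 2)) (Icc t₀ t₁) t := by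
  have := (EuclideanSpace.proj (𝕜 := ℝ) (0 : Fin 3)).hasFDerivAt.comp_hasDerivWithinAt t
    (hu.hasDerivWithinAt_Icc h0 t ht)
  convert! this using 1
  have hN := norm_sq_eq_coords (u t)
  simp [glField, axisField]
  linear_combination (a + α * u t 0) * hN

theorem transverse_eq_zero (hα : 0 < α) {x : ℝ} {u : ℝ → Magnetization}
    (hu : IsSolution (glField b c a α) (onAxis x) u) {t : ℝ} (ht : 0 ≤ t) :
    u t 1 = 0 ∧ u t 2 = 0 :=
  mem_axis_iff.1 ((glField_isDissipative hα).mem_of_isSolution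
    (fun _ hx => glField_mem_axis hx) (onAxis_mem_axis x) hu ht)

theorem eventually_norm_le (hα : 0 < α) {φ : Magnetization} {u : ℝ → Magnetization}
    (hu : IsSolution (glField b c a α) φ u) : ∃ R, ∀ᶠ t in atTop, ‖u t‖ ≤ R := by
  obtain ⟨R, hφR, -, hR⟩ := (glField_isDissipative (b := b) (c := c) (a := a) hα).exists_bound ‖φ‖
  exact ⟨R, (eventually_ge_atTop 0).mono fun t ht => hu.norm_le hφR hR ht⟩

/-- The cubic is positive between `q` and `s`, so a level `m` there cannot be crossed downwards. -/
theorem AxisRoots.tendsto_of_lt (h : AxisRoots b a α p q s) (hα : 0 < α) {x : ℝ} (hx : q < x)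
    {u : ℝ → Magnetization} (hu : IsSolution (glField b c a α) (onAxis x) u) :
    Tendsto u atTop (𝓝 (onAxis s)) := by
  obtain ⟨m, hqm, hm⟩ := exists_between (lt_min hx h.lt_right)
  rw [lt_min_iff] at hm
  have hev : ∀ t, 0 ≤ t → m ≤ u t 0 := by
    intro t ht
    have := le_of_deriv_neg_at_level (D := fun t => -u t 0) (l := -m)
      (fun r hr => (hasDerivWithinAt_coord_zero hu le_rfl hr).neg)
      (by simp [hu.1, onAxis, hm.1.le]) (fun r hr hl => by
        obtain ⟨h1, h2⟩ := transverse_eq_zero hα hu hr.1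
        have hmr : u r 0 = m := neg_injective hl
        rw [h1, h2, hmr, h.axisField_eq]
        have := mul_pos hα (mul_pos (mul_pos (sub_pos.2 (h.lt_left.trans hqm)) (sub_pos.2 hqm))
          (sub_pos.2 hm.2))
        linarith) t (right_mem_Icc.2 ht)
    linarith
  have h1 : Tendsto (fun t => u t 1) atTop (𝓝 0) := tendsto_const_nhds.congr' <|
    (eventually_ge_atTop 0).mono fun t ht => (transverse_eq_zero hα hu ht).1.symm
  have h2 : Tendsto (fun t => u t 2) atTop (𝓝 0) := tendsto_const_nhds.congr' <|
    (eventually_ge_atTop 0).mono fun t ht => (transverse_eq_zero hα hu ht).2.symm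
  obtain ⟨R, hR⟩ := eventually_norm_le hα hu
  exact h.tendsto_upper hα hqm ((eventually_ge_atTop 0).mono hev)
    (tendsto_axisField hR (tendsto_glField_of_isSolution hα hu) h1 h2) h1 h2

theorem AxisRoots.tendsto_of_gt (h : AxisRoots b a α p q s) (hα : 0 < α) {x : ℝ} (hx : x < q)
    {u : ℝ → Magnetization} (hu : IsSolution (glField b c a α) (onAxis x) u) :
    Tendsto u atTop (𝓝 (onAxis p)) := by
  have hu' := hu.glField_neg
  rw [neg_onAxis] at hu'
  have := h.neg.tendsto_of_lt hα (neg_lt_neg hx) hu'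
  rw [← neg_onAxis] at this
  simpa using this.neg

theorem AxisRoots.mid_mem_basin (h : AxisRoots b a α p q s) (hα : 0 < α) :
    onAxis q ∈ basin (glField b c a α) (onAxis q) := by
  refine (glField_isDissipative hα).mem_basin_of_solution (u := fun _ => onAxis q)
    ⟨rfl, fun t _ => ?_⟩ tendsto_const_nhds
  rw [glField_onAxis, h.axisField_eq, sub_self, mul_zero, zero_mul, mul_zero, onAxis_zero]
  exact hasDerivWithinAt_const _ _ _

theorem AxisRoots.onAxis_mem_basin_right (h : AxisRoots b a α p q s) (hα : 0 < α) {x : ℝ}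
    (hx : q < x) : onAxis x ∈ basin (glField b c a α) (onAxis s) :=
  (glField_isDissipative hα).mem_basin_iff.2 fun _ hu => h.tendsto_of_lt hα hx hu

theorem AxisRoots.onAxis_mem_basin_left (h : AxisRoots b a α p q s) (hα : 0 < α) {x : ℝ}
    (hx : x < q) : onAxis x ∈ basin (glField b c a α) (onAxis p) :=
  (glField_isDissipative hα).mem_basin_iff.2 fun _ hu => h.tendsto_of_gt hα hx hu

theorem AxisRoots.basin_right (h : AxisRoots b a α p q s) (hα : 0 < α) :
    {x | onAxis x ∈ basin (glField b c a α) (onAxis s)} = Ioi q := by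
  ext x
  refine ⟨fun hx => ?_, fun hx => h.onAxis_mem_basin_right hα hx⟩
  by_contra hxq
  rw [mem_Ioi, not_lt] at hxq
  rcases hxq.lt_or_eq with hlt | rfl
  · exact (disjoint_basin (onAxis_injective.ne (h.lt_left.trans h.lt_right).ne)).le_bot
      ⟨h.onAxis_mem_basin_left hα hlt, hx⟩
  · exact (disjoint_basin (onAxis_injective.ne h.lt_right.ne)).le_bot ⟨h.mid_mem_basin hα, hx⟩

theorem AxisRoots.basin_left (h : AxisRoots b a α p q s) (hα : 0 < α) :
    {x | onAxis x ∈ basin (glField b c a α) (onAxis p)} = Iio q := by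
  ext x
  refine ⟨fun hx => ?_, fun hx => h.onAxis_mem_basin_left hα hx⟩
  by_contra hxq
  rw [mem_Iio, not_lt] at hxq
  rcases hxq.lt_or_eq with hlt | rfl
  · exact (disjoint_basin (onAxis_injective.ne (h.lt_left.trans h.lt_right).ne')).le_bot
      ⟨h.onAxis_mem_basin_right hα hlt, hx⟩
  · exact (disjoint_basin (onAxis_injective.ne h.lt_left.ne')).le_bot ⟨h.mid_mem_basin hα, hx⟩

theorem AxisRoots.stable_left (h : AxisRoots b a α p q s) (hα : 0 < α) (hcb : 3 * c < 2 * b)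
    (hc : c < 0) : IsAsymptoticallyStable (glField b c a α) (onAxis p) := by
  have hf : axisField b a α p = 0 := by rw [h.axisField_eq]; ring
  have hd : b - 6 * a * p - 3 * α * p ^ 2 = -(α * ((q - p) * (s - p))) := by
    linear_combination h.pairs - 2 * p * h.sum
  have := mul_pos hα (mul_pos (sub_pos.2 h.lt_left) (sub_pos.2 (h.lt_left.trans h.lt_right)))
  refine isAsymptoticallyStable_glField hα hf (by linarith) ?_
  rw [axisField] at hf
  rcases eq_or_ne p 0 with rfl | hp
  · simpa using hc
  -- At a nonzero root the transverse eigenvalue becomes `c - 2b/3 - αp²/3`; this is where `3c < 2b`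
  -- enters.
  · have hb : b = 3 * a * p + α * p ^ 2 := mul_right_cancel₀ hp (by linarith)
    nlinarith [mul_nonneg hα.le (sq_nonneg p)]

theorem AxisRoots.stable_right (h : AxisRoots b a α p q s) (hα : 0 < α) (hcb : 3 * c < 2 * b)
    (hc : c < 0) : IsAsymptoticallyStable (glField b c a α) (onAxis s) := by
  have hf : axisField b a α s = 0 := by rw [h.axisField_eq]; ring
  have hd : b - 6 * a * s - 3 * α * s ^ 2 = -(α * ((s - p) * (s - q))) := by
    linear_combination h.pairs - 2 * s * h.sum
  have := mul_pos hα (mul_pos (sub_pos.2 (h.lt_left.trans h.lt_right)) (sub_pos.2 h.lt_right))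
  refine isAsymptoticallyStable_glField hα hf (by linarith) ?_
  rw [axisField] at hf
  rcases eq_or_ne s 0 with rfl | hs
  · simpa using hc
  · have hb : b = 3 * a * s + α * s ^ 2 := mul_right_cancel₀ hs (by linarith)
    nlinarith [mul_nonneg hα.le (sq_nonneg s)]

theorem AxisRoots.not_stable_mid (h : AxisRoots b a α p q s) (hα : 0 < α) :
    ¬ IsAsymptoticallyStable (glField b c a α) (onAxis q) := by
  rintro ⟨-, -, δ, hδ, hsub⟩
  have hmem : onAxis (q + δ / 2) ∈ Metric.ball (onAxis q) δ := by
    have : onAxis (q + δ / 2) - onAxis q = onAxis (δ / 2) := by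
      ext i; fin_cases i <;> simp [onAxis]
    rw [mem_ball_iff_norm, this, norm_onAxis, abs_of_pos (by positivity)]
    linarith
  exact (disjoint_basin (onAxis_injective.ne h.lt_right.ne)).le_bot
    ⟨hsub hmem, h.onAxis_mem_basin_right hα (by linarith)⟩

theorem AxisRoots.stable_iff (h : AxisRoots b a α p q s) (hα : 0 < α) (hcb : 3 * c < 2 * b)
    (hcb' : c < b) (hc : c < 0) (M : Magnetization) :
    IsAsymptoticallyStable (glField b c a α) M ↔ M = onAxis p ∨ M = onAxis s := by
  constructor
  · intro hM
    obtain ⟨h1, h2⟩ := eq_onAxis_of_glField_eq_zero hα hc hcb' hM.1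
    rw [h.axisField_eq] at h2
    simp only [neg_mul, neg_eq_zero, mul_eq_zero, hα.ne', false_or, sub_eq_zero] at h2
    rcases h2 with (h2 | h2) | h2
    · exact Or.inl (h1.trans (by rw [h2]))
    · rw [h1, h2] at hM
      exact absurd hM (h.not_stable_mid hα)
    · exact Or.inr (h1.trans (by rw [h2]))
  · rintro (rfl | rfl)
    exacts [h.stable_left hα hcb hc, h.stable_right hα hcb hc]

theorem isAsymptoticallyStable_zero (hα : 0 < α) (hb : b < 0) (hc : c < 0) :
    IsAsymptoticallyStable (glField b c a α) 0 := by
  rw [← onAxis_zero]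
  exact isAsymptoticallyStable_glField hα (by simp [axisField]) (by simpa) (by simpa)

theorem AxisRoots.tendsto_of_neg (h : AxisRoots b a α p 0 s) (hα : 0 < α) (ha : 0 < a)
    (hb : 0 < b) (hc : c < 0) {φ : Magnetization} {u : ℝ → Magnetization}
    (hu : IsSolution (glField b c a α) φ u) {t₀ : ℝ} (ht₀ : 0 ≤ t₀) (hneg : u t₀ 0 < 0) :
    Tendsto u atTop (𝓝 (onAxis p)) := by
  -- On the plane at level `-e` the transverse term `-(a - αe)r²` and the cubic are both of the
  -- right sign, because `αe ≤ a`. The half-space to its left is therefore trapping.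
  set e := min (-u t₀ 0) (a / α) with he
  have he0 : 0 < e := lt_min (by linarith) (by positivity)
  have hea : α * e ≤ a := by
    rw [mul_comm, ← le_div_iff₀ hα]
    exact min_le_right _ _
  have hev : ∀ t, t₀ ≤ t → u t 0 ≤ -e := by
    intro t ht
    refine le_of_deriv_neg_at_level (fun r hr => hasDerivWithinAt_coord_zero hu ht₀ hr)
      (by linarith [min_le_left (-u t₀ 0) (a / α)]) (fun r hr hl => ?_) t (right_mem_Icc.2 ht)
    rw [hl, axisField]
    have e1 : 0 ≤ (a + α * -e) * (u r 1 ^ 2 + u r 2 ^ 2) := by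
      apply mul_nonneg <;> [linarith; positivity]
    have e2 := mul_le_mul_of_nonneg_right hea (sq_nonneg e)
    nlinarith [mul_pos hb he0, mul_pos ha (pow_pos he0 2)]
  have h1 := tendsto_transverse hα hc (hc.trans hb) hu 1 (by decide)
  have h2 := tendsto_transverse hα hc (hc.trans hb) hu 2 (by decide)
  obtain ⟨R, hR⟩ := eventually_norm_le hα hu
  exact h.tendsto_lower hα (neg_lt_zero.2 he0) ((eventually_ge_atTop t₀).mono hev)
    (tendsto_axisField hR (tendsto_glField_of_isSolution hα hu) h1 h2) h1 h2

theorem norm_le_sum_abs (M : Magnetization) : ‖M‖ ≤ |M 0| + |M 1| + |M 2| := by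
  refine (sq_le_sq₀ (norm_nonneg _) (by positivity)).1 ?_
  rw [norm_sq_eq_coords]
  nlinarith [sq_abs (M 0), sq_abs (M 1), sq_abs (M 2), mul_nonneg (abs_nonneg (M 0)) (abs_nonneg (M 1)),
    mul_nonneg (abs_nonneg (M 0)) (abs_nonneg (M 2)), mul_nonneg (abs_nonneg (M 1)) (abs_nonneg (M 2))]

theorem AxisRoots.limsupNorm_le_of_nonneg (h : AxisRoots b a α p 0 s) (hα : 0 < α)
    (hb : 0 < b) (hc : c < 0) {φ : Magnetization} {u : ℝ → Magnetization}
    (hu : IsSolution (glField b c a α) φ u) (hpos : ∀ t, 0 ≤ t → 0 ≤ u t 0) :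
    limsupNorm u ≤ ENNReal.ofReal s := by
  have h1 := tendsto_transverse hα hc (hc.trans hb) hu 1 (by decide)
  have h2 := tendsto_transverse hα hc (hc.trans hb) hu 2 (by decide)
  obtain ⟨R, hR⟩ := eventually_norm_le hα hu
  have hf := tendsto_axisField hR (tendsto_glField_of_isSolution hα hu) h1 h2
  refine limsupNorm_le_of_forall h.lt_right.le fun ε hε => ?_
  set η := ε / 3 with hη
  have hη0 : 0 < η := by positivity
  filter_upwards [eventually_ge_atTop 0,
    hf.norm.eventually_lt_const (u := α * η ^ 3) (by rw [norm_zero]; positivity),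
    h1.norm.eventually_lt_const (u := η) (by simpa using hη0),
    h2.norm.eventually_lt_const (u := η) (by simpa using hη0)] with t ht0 htf ht1 ht2
  have hx0 := hpos t ht0
  -- Right of `s + η` each of the three factors of the cubic is at least `η`, so its modulus is at
  -- least `αη³`.
  have hx : u t 0 ≤ s + η := by
    by_contra! hgt
    refine absurd htf (not_lt.2 ?_)
    have hp := h.lt_left
    have hs := h.lt_right
    rw [h.axisField_eq, neg_mul, norm_neg, Real.norm_eq_abs]
    refine le_trans ?_ (le_abs_self _)
    rw [pow_succ, pow_two]
    have e1 : η ≤ u t 0 - p := by linarith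
    have e2 : η ≤ u t 0 - 0 := by linarith
    have e3 : η ≤ u t 0 - s := by linarith
    gcongr
    · exact mul_nonneg (by linarith) (by linarith)
    · linarith
  refine (norm_le_sum_abs _).trans ?_
  rw [Real.norm_eq_abs] at ht1 ht2
  rw [abs_of_nonneg hx0]
  linarith

theorem AxisRoots.limsupNorm_le_of_notMem_left (h : AxisRoots b a α p 0 s) (hα : 0 < α)
    (ha : 0 < a) (hb : 0 < b) (hc : c < 0) {φ : Magnetization}
    (hφ : φ ∉ basin (glField b c a α) (onAxis p)) {u : ℝ → Magnetization}
    (hu : IsSolution (glField b c a α) φ u) : limsupNorm u ≤ ENNReal.ofReal s := by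
  refine h.limsupNorm_le_of_nonneg hα hb hc hu fun t ht => ?_
  by_contra! hneg
  exact hφ ((glField_isDissipative hα).mem_basin_of_solution hu
    (h.tendsto_of_neg hα ha hb hc hu ht hneg))

theorem AxisRoots.limsupNorm_le_of_notMem_right (h : AxisRoots b a α p 0 s) (hα : 0 < α)
    (ha : a < 0) (hb : 0 < b) (hc : c < 0) {φ : Magnetization}
    (hφ : φ ∉ basin (glField b c a α) (onAxis s)) {u : ℝ → Magnetization}
    (hu : IsSolution (glField b c a α) φ u) : limsupNorm u ≤ ENNReal.ofReal (-p) := by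
  have h' := h.neg
  rw [neg_zero] at h'
  have hφ' : -φ ∉ basin (glField b c (-a) α) (onAxis (-s)) := by
    intro hmem
    refine hφ ((glField_isDissipative hα).mem_basin_of_solution hu ?_)
    have := (hmem.2 _ hu.glField_neg).neg
    rw [neg_onAxis, neg_neg] at this
    simpa using this
  have := h'.limsupNorm_le_of_notMem_left hα (neg_pos.2 ha) hb hc hφ' hu.glField_neg
  simpa [limsupNorm] using this

/-- The condition on `δ` makes the cubic at least `(b / 2)|x|` in modulus for `|x| ≤ δ`, so `0` is
the only possible limit. The contrapositive is the lower bound off the stable manifold. -/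
theorem mem_basin_zero_of_limsupNorm_lt (hα : 0 < α) (hb : 0 < b) (hc : c < 0) {δ : ℝ}
    (hδ : 3 * |a| * δ + α * δ ^ 2 ≤ b / 2) {φ : Magnetization} {u : ℝ → Magnetization}
    (hu : IsSolution (glField b c a α) φ u) (hlim : limsupNorm u < ENNReal.ofReal δ) :
    φ ∈ basin (glField b c a α) 0 := by
  have h1 := tendsto_transverse hα hc (hc.trans hb) hu 1 (by decide)
  have h2 := tendsto_transverse hα hc (hc.trans hb) hu 2 (by decide)
  obtain ⟨R, hR⟩ := eventually_norm_le hα hu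
  have hf := tendsto_axisField hR (tendsto_glField_of_isSolution hα hu) h1 h2
  rw [← onAxis_zero]
  refine (glField_isDissipative hα).mem_basin_of_solution hu (tendsto_onAxis ?_ h1 h2)
  have hlim2 := hf.norm.const_mul (2 / b)
  rw [norm_zero, mul_zero] at hlim2
  refine squeeze_zero_norm' ?_ hlim2
  filter_upwards [eventually_norm_lt_of_limsupNorm_lt hlim] with t ht
  have hx := (abs_coord_le_norm (u t) 0).trans ht.le
  have hfac : axisField b a α (u t 0) = (b - 3 * a * u t 0 - α * u t 0 ^ 2) * u t 0 := by
    rw [axisField]; ring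
  have e1 : a * u t 0 ≤ |a| * δ := (le_abs_self _).trans (by rw [abs_mul]; gcongr)
  have e2 : α * u t 0 ^ 2 ≤ α * δ ^ 2 := by
    rw [← sq_abs]
    gcongr
  have e3 : b / 2 ≤ |b - 3 * a * u t 0 - α * u t 0 ^ 2| :=
    le_trans (by linarith) (le_abs_self _)
  rw [hfac, norm_mul, Real.norm_eq_abs, Real.norm_eq_abs, ← mul_assoc]
  refine le_mul_of_one_le_left (abs_nonneg _) ?_
  calc (1 : ℝ) = 2 / b * (b / 2) := by field_simp
    _ ≤ _ := by gcongr

/-- Strict differentiability controls differences of the field at two points near `0`, as the cone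
condition requires. -/
theorem hasStrictFDerivAt_glField_zero : HasStrictFDerivAt (glField b c a α)
    (c • ContinuousLinearMap.id ℝ Magnetization
      + (b - c) • (EuclideanSpace.proj (𝕜 := ℝ) (0 : Fin 3)).smulRight (onAxis 1)) 0 := by
  have h0 : HasStrictFDerivAt (fun M : Magnetization => M 0)
      (EuclideanSpace.proj (𝕜 := ℝ) (0 : Fin 3)) 0 :=
    (EuclideanSpace.proj (𝕜 := ℝ) (0 : Fin 3)).hasStrictFDerivAt
  have hid := hasStrictFDerivAt_id (𝕜 := ℝ) (0 : Magnetization)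
  have hn := hasStrictFDerivAt_norm_sq (0 : Magnetization)
  have := (((hid.const_smul c).add ((h0.const_mul (b - c)).smul_const (onAxis 1))).sub
    ((h0.const_mul (2 * a)).smul hid)).sub
    (hn.smul ((hid.const_smul α).const_add (a • onAxis 1)))
  rw [show glField b c a α = _ from funext glField_eq]
  convert! this using 1
  ext M i
  simp
  ring

theorem dimH_basin_zero_le_two (hα : 0 < α) (hb : 0 < b) (hc : c < 0) :
    dimH (basin (glField b c a α) 0) ≤ 2 := by
  -- `J = diag(1, -1, -1)` matches the signs of the linear part `diag(b, c, c)`: their pairing is at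
  -- least `min b (-c)` times the squared norm, which absorbs the nonlinear remainder.
  let J : Magnetization →L[ℝ] Magnetization :=
    2 • (EuclideanSpace.proj (𝕜 := ℝ) (0 : Fin 3)).smulRight (onAxis 1)
      - ContinuousLinearMap.id ℝ Magnetization
  have hJ0 : ∀ M, J M 0 = M 0 := fun M => by simp [J, onAxis]; ring
  have hJ1 : ∀ M, J M 1 = -M 1 := fun M => by simp [J, onAxis]
  have hJ2 : ∀ M, J M 2 = -M 2 := fun M => by simp [J, onAxis]
  have hJn : ∀ M, ‖J M‖ = ‖M‖ := fun M => by
    rw [← sq_eq_sq₀ (norm_nonneg _) (norm_nonneg _), norm_sq_eq_coords, norm_sq_eq_coords,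
      hJ0, hJ1, hJ2]
    ring
  let π : Magnetization →L[ℝ] ℝ × ℝ :=
    (EuclideanSpace.proj (𝕜 := ℝ) (1 : Fin 3)).prod (EuclideanSpace.proj (𝕜 := ℝ) (2 : Fin 3))
  set k := min b (-c) with hk
  have hk0 : 0 < k := lt_min hb (neg_pos.2 hc)
  have hlo := (hasStrictFDerivAt_glField_zero (b := b) (c := c) (a := a) (α := α)).isLittleO.def hk0
  rw [nhds_prod_eq] at hlo
  obtain ⟨t, ht, hlo⟩ := mem_prod_self_iff.1 hlo
  obtain ⟨η, hη, hball⟩ := Metric.nhds_basis_closedBall.mem_iff.1 ht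
  have := (glField_isDissipative (b := b) (c := c) (a := a) hα).dimH_basin_zero_le J
    (fun x y => by simp only [inner_eq_coords, hJ0, hJ1, hJ2]; ring) π hη zero_le_two
    (fun w hw => ?_) (fun x hx y hy => ?_)
  · simpa using this
  · rw [inner_eq_coords, hJ0, hJ1, hJ2] at hw
    -- In the complementary cone the axial square is at most the sum of the transverse squares, so
    -- `‖w‖²` is at most twice that sum, hence at most four times the squared sup norm of `π w`.
    refine (sq_le_sq₀ (norm_nonneg _) (by positivity)).1 ?_
    have h1 : |w 1| ≤ ‖π w‖ := le_max_left |w 1| |w 2|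
    have h2 : |w 2| ≤ ‖π w‖ := le_max_right |w 1| |w 2|
    have h1' := pow_le_pow_left₀ (abs_nonneg _) h1 2
    have h2' := pow_le_pow_left₀ (abs_nonneg _) h2 2
    rw [sq_abs] at h1' h2'
    rw [norm_sq_eq_coords]
    nlinarith
  · have h1 := hlo (mk_mem_prod (hball hx) (hball hy))
    simp only [mem_ofPred_eq] at h1
    set w := x - y with hw
    set A := (c • ContinuousLinearMap.id ℝ Magnetization
      + (b - c) • (EuclideanSpace.proj (𝕜 := ℝ) (0 : Fin 3)).smulRight (onAxis 1)) with hA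
    have h2 : ⟪J w, A w⟫ = b * w 0 ^ 2 - c * (w 1 ^ 2 + w 2 ^ 2) := by
      rw [inner_eq_coords, hJ0, hJ1, hJ2]
      simp [hA, onAxis]
      ring
    have h3 : k * ‖w‖ ^ 2 ≤ ⟪J w, A w⟫ := by
      rw [h2, norm_sq_eq_coords]
      nlinarith [mul_le_mul_of_nonneg_right (min_le_left b (-c)) (sq_nonneg (w 0)),
        mul_le_mul_of_nonneg_right (min_le_right b (-c)) (sq_nonneg (w 1)),
        mul_le_mul_of_nonneg_right (min_le_right b (-c)) (sq_nonneg (w 2))]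
    have h4 := abs_real_inner_le_norm (J w) (glField b c a α x - glField b c a α y - A w)
    have h5 := (abs_le.1 h4).1
    rw [inner_sub_right, hJn] at h5
    nlinarith [mul_le_mul_of_nonneg_left h1 (norm_nonneg w)]

end Dynamics

/-- A neighbourhood decomposition as in a mixed transition, obtained from an open set `B` of
initial values with a jump and an open set disjoint from it, both touching `0`. -/
theorem mixed_decomposition_of_isOpen {X : Type*} [NormedAddCommGroup X] [NormedSpace ℝ X]
    {V : ℝ → X → X} {T₁ : ℝ} {A B : ℝ → Set X} {ρ : ℝ → ℝ} {δ : ℝ} (hδ : 0 < δ)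
    (hρ : Tendsto ρ (𝓝[<] T₁) (𝓝 0))
    (h : ∀ᶠ T in 𝓝[<] T₁, IsOpen (A T) ∧ IsOpen (B T) ∧ Disjoint (A T) (B T) ∧
      (0 : X) ∈ closure (A T) ∧ (0 : X) ∈ closure (B T) ∧
      (∀ φ ∉ B T, TheSolution (V T) φ fun u => limsupNorm u ≤ ENNReal.ofReal (ρ T)) ∧
      ∀ φ ∈ B T, TheSolution (V T) φ fun u => ENNReal.ofReal δ ≤ limsupNorm u) :
    ∃ U : Set X, IsOpen U ∧ (0 : X) ∈ U ∧ ∃ U₁ U₂ : ℝ → Set X,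
    ∃ ρ : ℝ → ℝ≥0∞, Tendsto ρ (𝓝[<] T₁) (𝓝 0) ∧ ∃ δ : ℝ, 0 < δ ∧
    ∀ᶠ T in 𝓝[<] T₁,
      IsOpen (U₁ T) ∧ IsOpen (U₂ T) ∧ U₁ T ⊆ U ∧ U₂ T ⊆ U ∧ Disjoint (U₁ T) (U₂ T) ∧
      (0 : X) ∈ closure (U₁ T) ∧ (0 : X) ∈ closure (U₂ T) ∧
      closure U = closure (U₁ T) ∪ closure (U₂ T) ∧
      (∀ φ ∈ U₁ T, TheSolution (V T) φ fun u => limsupNorm u ≤ ρ T) ∧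
      ∀ φ ∈ U₂ T, TheSolution (V T) φ fun u => ENNReal.ofReal δ ≤ limsupNorm u := by
  -- The complement of the closure of `B T`, rather than `A T`, makes the covering of the closures
  -- automatic. `A T` only shows that this complement touches `0`.
  refine ⟨univ, isOpen_univ, mem_univ _, fun T => (closure (B T))ᶜ, B,
    fun T => ENNReal.ofReal (ρ T), by simpa using ENNReal.tendsto_ofReal hρ, δ, hδ, ?_⟩
  filter_upwards [h] with T ⟨hA, hB, hAB, h0A, h0B, hle, hge⟩
  have hsub : A T ⊆ (closure (B T))ᶜ :=
    subset_compl_iff_disjoint_right.2 (hAB.closure_right hA)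
  refine ⟨isClosed_closure.isOpen_compl, hB, subset_univ _, subset_univ _,
    disjoint_compl_left.mono_right subset_closure, closure_mono hsub h0A, h0B, ?_,
    fun φ hφ => hle φ fun hmem => hφ (subset_closure hmem), hge⟩
  rw [closure_univ, eq_comm, eq_univ_iff_forall]
  intro x
  by_cases hx : x ∈ closure (B T)
  exacts [Or.inr hx, Or.inl (subset_closure hx)]

theorem finrank_axis : Module.finrank ℝ axis = 1 :=
  finrank_span_singleton fun h => by
    have := congrArg norm h
    simp [norm_onAxis] at this

theorem infDist_axis_le (M : Magnetization) :
    Metric.infDist M (axis : Set Magnetization) ≤ |M 1| + |M 2| := by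
  refine (Metric.infDist_le_dist_of_mem (onAxis_mem_axis (M 0))).trans ?_
  rw [dist_eq_norm]
  simpa [onAxis] using norm_le_sum_abs (M - onAxis (M 0))

theorem AxisRoots.basin_zero_inter_axis {b c a α p s : ℝ} (h : AxisRoots b a α p 0 s) (hα : 0 < α)
    {M : Magnetization} (hM : M ∈ axis) (hb : M ∈ basin (glField b c a α) 0) : M = 0 := by
  rw [mem_axis_iff] at hM
  have hM' := eq_onAxis hM.1 hM.2
  rw [hM', ← onAxis_zero] at hb
  rcases lt_trichotomy (M 0) 0 with h0 | h0 | h0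
  · exact absurd hb (Set.disjoint_left.1 (disjoint_basin (onAxis_injective.ne h.lt_left.ne))
      (h.onAxis_mem_basin_left hα h0))
  · rw [hM', h0, onAxis_zero]
  · exact absurd hb (Set.disjoint_left.1 (disjoint_basin (onAxis_injective.ne h.lt_right.ne'))
      (h.onAxis_mem_basin_right hα h0))

/-! ### Roots and coefficients as functions of the temperature -/

namespace Ferromagnet

variable {P : Ferromagnet} {I : Set ℝ} {T T₁ : ℝ}

theorem shiftedField_isDissipative (hα : 0 < P.α₄ T) : IsDissipative (P.shiftedField T) :=
  glField_isDissipative hα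

theorem shiftedField_mem_axis : ∀ M ∈ axis, P.shiftedField T M ∈ axis :=
  fun _ hM => glField_mem_axis hM

theorem rootPlus_add_rootMinus (hα : 0 < P.α₄ T) :
    P.α₄ T * (P.rootPlus T + P.rootMinus T) = -3 * P.a₂ T := by
  rw [rootPlus, rootMinus]
  field_simp
  ring

theorem rootPlus_mul_rootMinus (hα : 0 < P.α₄ T) (hd : 0 ≤ P.disc T) :
    P.α₄ T * (P.rootPlus T * P.rootMinus T) = -P.β₁ T := by
  have hs : √(P.disc T) ^ 2 = 9 * P.a₂ T ^ 2 + 4 * P.α₄ T * P.β₁ T := Real.sq_sqrt hd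
  rw [rootPlus, rootMinus]
  field_simp
  linear_combination -hs

theorem rootMinus_lt_rootPlus (hα : 0 < P.α₄ T) (hd : 0 < P.disc T) :
    P.rootMinus T < P.rootPlus T := by
  have hs := Real.sqrt_pos.2 hd
  have : P.rootPlus T - P.rootMinus T = √(P.disc T) / P.α₄ T := by
    rw [rootPlus, rootMinus]
    field_simp
    ring
  have := div_pos hs hα
  linarith

theorem β₁_eq (hα₀ : 0 < P.α₀) : P.β₁ T = P.α₀ * (P.criticalCurve T - T) := by
  rw [β₁, criticalCurve, α₂]
  field_simp
  ring

theorem disc_pos_of_β₁_pos (hα : 0 < P.α₄ T) (hb : 0 < P.β₁ T) : 0 < P.disc T := by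
  rw [disc]
  positivity

/-- The nonzero roots have product `-β₁/α₄ < 0`, so they lie on both sides of `0`. -/
theorem axisRoots_of_β₁_pos (hα : 0 < P.α₄ T) (hb : 0 < P.β₁ T) :
    AxisRoots (P.β₁ T) (P.a₂ T) (P.α₄ T) (P.rootMinus T) 0 (P.rootPlus T) := by
  have hd := disc_pos_of_β₁_pos hα hb
  have hlt := rootMinus_lt_rootPlus hα hd
  have hs := rootPlus_add_rootMinus hα
  have hm := rootPlus_mul_rootMinus hα hd.le
  have hneg : P.rootPlus T * P.rootMinus T < 0 := by
    by_contra! h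
    nlinarith [mul_nonneg hα.le h]
  rcases mul_neg_iff.1 hneg with h | h
  · exact ⟨h.2, h.1, by linarith, by linarith, by ring⟩
  · linarith

/-- Here the product `-β₁/α₄` is positive and the sum `-3a₂/α₄` negative, so both nonzero roots are
negative. -/
theorem axisRoots_of_a₂_pos (hα : 0 < P.α₄ T) (hb : P.β₁ T < 0) (ha : 0 < P.a₂ T)
    (hd : 0 < P.disc T) :
    AxisRoots (P.β₁ T) (P.a₂ T) (P.α₄ T) (P.rootMinus T) (P.rootPlus T) 0 := by
  have hlt := rootMinus_lt_rootPlus hα hd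
  have hs := rootPlus_add_rootMinus hα
  have hm := rootPlus_mul_rootMinus hα hd.le
  have hpos : 0 < P.rootPlus T * P.rootMinus T := pos_of_mul_pos_right (by linarith) hα.le
  have hsum : P.rootPlus T + P.rootMinus T < 0 := by
    by_contra! h
    nlinarith [mul_nonneg hα.le h]
  rcases mul_pos_iff.1 hpos with h | h
  · linarith
  · exact ⟨hlt, h.1, by linarith, by linarith, by ring⟩

theorem axisRoots_of_a₂_neg (hα : 0 < P.α₄ T) (hb : P.β₁ T < 0) (ha : P.a₂ T < 0)
    (hd : 0 < P.disc T) :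
    AxisRoots (P.β₁ T) (P.a₂ T) (P.α₄ T) 0 (P.rootMinus T) (P.rootPlus T) := by
  have hlt := rootMinus_lt_rootPlus hα hd
  have hs := rootPlus_add_rootMinus hα
  have hm := rootPlus_mul_rootMinus hα hd.le
  have hpos : 0 < P.rootPlus T * P.rootMinus T := pos_of_mul_pos_right (by linarith) hα.le
  have hsum : 0 < P.rootPlus T + P.rootMinus T := by
    by_contra! h
    nlinarith [mul_nonpos_of_nonneg_of_nonpos hα.le h]
  rcases mul_pos_iff.1 hpos with h | h
  · exact ⟨h.2, hlt, by linarith, by linarith, by ring⟩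
  · linarith

/-- The situation at a critical temperature `T₁` with a transversally stable critical state. -/
structure CriticalPoint (P : Ferromagnet) (T₁ : ℝ) : Prop where
  α₄_pos : 0 < P.α₄ T₁
  α₄_cont : ContinuousAt P.α₄ T₁
  a₂_cont : ContinuousAt P.a₂ T₁
  β₁_cont : ContinuousAt P.β₁ T₁
  β₂_cont : ContinuousAt P.β₂ T₁
  β₁_eq_zero : P.β₁ T₁ = 0
  β₂_neg : P.β₂ T₁ < 0
  β₁_pos : ∀ᶠ T in 𝓝[<] T₁, 0 < P.β₁ T
  β₁_neg : ∀ᶠ T in 𝓝[>] T₁, P.β₁ T < 0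

theorem Admissible.β₁_pos (hP : P.Admissible I) (hT₁ : P.IsCriticalTemperature I T₁)
    (hT : T ∈ I) (hlt : T < T₁) : 0 < P.β₁ T := by
  rw [β₁_eq hP.α₀_pos]
  exact mul_pos hP.α₀_pos (sub_pos.2 ((hT₁.2.2 T hT).1 hlt))

theorem Admissible.β₁_neg (hP : P.Admissible I) (hT₁ : P.IsCriticalTemperature I T₁)
    (hT : T ∈ I) (hlt : T₁ < T) : P.β₁ T < 0 := by
  rw [β₁_eq hP.α₀_pos]
  exact mul_neg_of_pos_of_neg hP.α₀_pos (sub_neg.2 ((hT₁.2.2 T hT).2 hlt))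

theorem Admissible.criticalPoint (hP : P.Admissible I) (hI : IsOpen I)
    (hT₁ : P.IsCriticalTemperature I T₁)
    (hlam : P.lam₁ T₁ > 2 * P.m₀ T₁ * (P.α₄ T₁ * P.m₀ T₁ - 2 * P.β T₁ * P.h)) :
    CriticalPoint P T₁ := by
  have hnhds := hI.mem_nhds hT₁.1
  have c1 := hP.α₄_cont.continuousAt hnhds
  have c2 := hP.β_cont.continuousAt hnhds
  have c3 := hP.lam₁_cont.continuousAt hnhds
  have c4 := hP.m₀_cont.continuousAt hnhds
  have c5 : ContinuousAt P.α₂ T₁ := by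
    unfold α₂
    fun_prop
  have h0 : P.β₁ T₁ = 0 := by rw [β₁_eq hP.α₀_pos, ← hT₁.2.1, sub_self, mul_zero]
  refine ⟨hP.α₄_pos _ hT₁.1, c1, ?_, ?_, ?_, h0, ?_, ?_, ?_⟩
  · unfold a₂; fun_prop
  · unfold β₁; fun_prop
  · unfold β₂; fun_prop
  -- The hypothesis on `lam₁` says exactly that `β₂ < β₁` at `T₁`, where `β₁` vanishes.
  · rw [β₁] at h0
    rw [β₂]
    linarith
  · filter_upwards [nhdsWithin_le_nhds hnhds, self_mem_nhdsWithin] with T hT hlt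
    exact hP.β₁_pos hT₁ hT hlt
  · filter_upwards [nhdsWithin_le_nhds hnhds, self_mem_nhdsWithin] with T hT hlt
    exact hP.β₁_neg hT₁ hT hlt

/-! ### The transition at the critical temperature -/

namespace CriticalPoint

theorem eventually_α₄_pos (h : CriticalPoint P T₁) : ∀ᶠ T in 𝓝 T₁, 0 < P.α₄ T :=
  h.α₄_cont.eventually_const_lt h.α₄_pos

theorem eventually_β₂_neg (h : CriticalPoint P T₁) : ∀ᶠ T in 𝓝 T₁, P.β₂ T < 0 :=
  h.β₂_cont.eventually_lt_const h.β₂_neg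

theorem eventually_β₂_lt_β₁ (h : CriticalPoint P T₁) :
    ∀ᶠ T in 𝓝 T₁, P.β₂ T < P.β₁ T ∧ 3 * P.β₂ T < 2 * P.β₁ T := by
  refine (h.β₂_cont.eventually_lt h.β₁_cont ?_).and
    ((h.β₂_cont.const_mul 3).eventually_lt (h.β₁_cont.const_mul 2) ?_)
  all_goals linarith [h.β₂_neg, h.β₁_eq_zero]

theorem disc_cont (h : CriticalPoint P T₁) : ContinuousAt P.disc T₁ := by
  have := h.α₄_cont
  have := h.a₂_cont
  have := h.β₁_cont
  unfold disc
  fun_prop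

theorem disc_eq (h : CriticalPoint P T₁) : P.disc T₁ = (3 * P.a₂ T₁) ^ 2 := by
  rw [disc, h.β₁_eq_zero]; ring

theorem eventually_disc_pos (h : CriticalPoint P T₁) (ha : P.a₂ T₁ ≠ 0) :
    ∀ᶠ T in 𝓝 T₁, 0 < P.disc T :=
  h.disc_cont.eventually_const_lt (by rw [h.disc_eq]; positivity)

theorem rootPlus_cont (h : CriticalPoint P T₁) : ContinuousAt P.rootPlus T₁ := by
  have := h.α₄_cont
  have := h.a₂_cont
  have := h.disc_cont.sqrt
  have := h.α₄_pos.ne'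
  unfold rootPlus
  fun_prop (disch := positivity)

theorem rootMinus_cont (h : CriticalPoint P T₁) : ContinuousAt P.rootMinus T₁ := by
  have := h.α₄_cont
  have := h.a₂_cont
  have := h.disc_cont.sqrt
  have := h.α₄_pos.ne'
  unfold rootMinus
  fun_prop (disch := positivity)

/-- A lower bound, valid near the critical temperature, for the distance to the origin of the states
to which the system passes. -/
theorem exists_transition_bound (h : CriticalPoint P T₁) :
    ∃ δ : ℝ → ℝ, Tendsto δ (𝓝[<] T₁) (𝓝 0) ∧ ∀ᶠ T in 𝓝[<] T₁, 0 < δ T ∧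
      3 * |P.a₂ T| * δ T + P.α₄ T * δ T ^ 2 ≤ P.β₁ T / 2 := by
  -- The summand `β₁` in the denominator forces `δ ≤ 1`, hence `δ² ≤ δ`; the rest gives `(3|a₂| +
  -- α₄)δ ≤ β₁ / 2`.
  refine ⟨fun T => P.β₁ T / (2 * (3 * |P.a₂ T| + P.α₄ T) + P.β₁ T), ?_, ?_⟩
  · have hD : 2 * (3 * |P.a₂ T₁| + P.α₄ T₁) + P.β₁ T₁ ≠ 0 := by
      have := h.α₄_pos
      rw [h.β₁_eq_zero]
      positivity
    have := h.β₁_cont.div ((((h.a₂_cont.abs.const_mul 3).add h.α₄_cont).const_mul 2).add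
      h.β₁_cont) hD
    have h2 := this.tendsto
    simp only [Pi.div_apply, h.β₁_eq_zero, zero_div] at h2
    exact h2.mono_left nhdsWithin_le_nhds
  · filter_upwards [h.β₁_pos, nhdsWithin_le_nhds h.eventually_α₄_pos] with T hb hα
    set D := 2 * (3 * |P.a₂ T| + P.α₄ T) + P.β₁ T with hD
    have hD0 : 0 < D := by positivity
    have h0 : 0 < P.β₁ T / D := by positivity
    have h1 : P.β₁ T / D ≤ 1 := by
      rw [div_le_one hD0, hD]
      have : 0 ≤ 2 * (3 * |P.a₂ T| + P.α₄ T) := by positivity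
      linarith
    have h2 : P.β₁ T / D * D = P.β₁ T := div_mul_cancel₀ _ hD0.ne'
    refine ⟨h0, ?_⟩
    nlinarith [mul_nonneg hα.le (mul_nonneg h0.le (sub_nonneg.2 h1)), mul_pos h0 hb]

theorem isAsymptoticallyStable_zero (h : CriticalPoint P T₁) :
    ∀ᶠ T in 𝓝[>] T₁, IsAsymptoticallyStable (P.shiftedField T) 0 := by
  filter_upwards [h.β₁_neg, nhdsWithin_le_nhds h.eventually_α₄_pos,
    nhdsWithin_le_nhds h.eventually_β₂_neg] with T hb hα hc
  exact _root_.isAsymptoticallyStable_zero hα hb hc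

theorem shiftedField_zero (P : Ferromagnet) (T : ℝ) : P.shiftedField T 0 = 0 := by
  ext i; fin_cases i <;> simp [shiftedField]

theorem limsupNorm_ge_of_notMem {δ : ℝ} (hα : 0 < P.α₄ T) (hb : 0 < P.β₁ T) (hc : P.β₂ T < 0)
    (hδ : 3 * |P.a₂ T| * δ + P.α₄ T * δ ^ 2 ≤ P.β₁ T / 2) {φ : Magnetization}
    (hφ : φ ∉ stableManifold (P.shiftedField T)) :
    TheSolution (P.shiftedField T) φ fun u => ENNReal.ofReal δ ≤ limsupNorm u :=
  (shiftedField_isDissipative hα).theSolution_iff.2 fun _ hu => not_lt.1 fun hlt =>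
    hφ (mem_basin_zero_of_limsupNorm_lt hα hb hc hδ hu hlt)

theorem hasTransitionBelow (h : CriticalPoint P T₁) : HasTransitionBelow P.shiftedField T₁ := by
  obtain ⟨δ, hδ0, hδ⟩ := h.exists_transition_bound
  refine ⟨Eventually.of_forall fun T => shiftedField_zero P T, h.isAsymptoticallyStable_zero,
    univ, univ_mem, δ, 0, le_rfl, hδ0, ?_⟩
  filter_upwards [hδ, h.β₁_pos, nhdsWithin_le_nhds h.eventually_α₄_pos,
    nhdsWithin_le_nhds h.eventually_β₂_neg] with T hδT hb hα hc
  refine ⟨hδT.1, ?_, fun φ hφ => limsupNorm_ge_of_notMem hα hb hc hδT.2 hφ.2⟩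
  calc dimH (stableManifold (P.shiftedField T)) + 1 ≤ 2 + 1 := by
        gcongr
        exact dimH_basin_zero_le_two hα hb hc
    _ = _ := by simp; norm_num

theorem hasTransitionBelow_axis (h : CriticalPoint P T₁) : HasTransitionBelow
    (fun T (x : axis) => axis.orthogonalProjectionOnto (P.shiftedField T (x : Magnetization)))
    T₁ := by
  obtain ⟨δ, hδ0, hδ⟩ := h.exists_transition_bound
  refine ⟨Eventually.of_forall fun T => by simp [shiftedField_zero], ?_,
    univ, univ_mem, δ, 0, le_rfl, hδ0, ?_⟩
  · filter_upwards [h.isAsymptoticallyStable_zero, nhdsWithin_le_nhds h.eventually_α₄_pos]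
      with T hT hα
    exact (shiftedField_isDissipative hα).isAsymptoticallyStable_restrict shiftedField_mem_axis hT
  filter_upwards [hδ, h.β₁_pos, nhdsWithin_le_nhds h.eventually_α₄_pos,
    nhdsWithin_le_nhds h.eventually_β₂_neg] with T hδT hb hα hc
  have hbasin := (shiftedField_isDissipative hα).basin_restrict shiftedField_mem_axis 0
  refine ⟨hδT.1, ?_, fun φ hφ => ?_⟩
  -- On the axis `0` is the separating root, so the stable manifold there is a single point.
  · rw [dimH_subsingleton, finrank_axis, zero_add, Nat.cast_one]
    rw [stableManifold, hbasin]
    have key : ∀ x : axis, (x : Magnetization) ∈ basin (P.shiftedField T) 0 → x = 0 :=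
      fun x hx => Subtype.ext ((axisRoots_of_β₁_pos hα hb).basin_zero_inter_axis hα x.2 hx)
    exact fun x hx y hy => (key x hx).trans (key y hy).symm
  · refine (shiftedField_isDissipative hα).theSolution_restrict shiftedField_mem_axis
      (limsupNorm_ge_of_notMem hα hb hc hδT.2 fun hmem => hφ.2 ?_)
    rw [stableManifold, hbasin]
    exact hmem

/-- Below the critical temperature one of the two nonzero states on the axis is close to `0`, the
other one stays away from `0`, and all solutions not attracted by the latter end up close to `0`. -/
theorem exists_near_and_far_state (h : CriticalPoint P T₁) (ha : P.a₂ T₁ ≠ 0) :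
    ∃ (σ θ : ℝ → ℝ) (δ : ℝ), 0 < δ ∧ Tendsto (fun T => |σ T|) (𝓝[<] T₁) (𝓝 0) ∧
    ∀ᶠ T in 𝓝[<] T₁, 0 < P.α₄ T ∧ δ ≤ |θ T| ∧ σ T ≠ θ T ∧
      IsAsymptoticallyStable (P.shiftedField T) (onAxis (σ T)) ∧
      IsAsymptoticallyStable (P.shiftedField T) (onAxis (θ T)) ∧
      0 ∈ closure {x | onAxis x ∈ basin (P.shiftedField T) (onAxis (σ T))} ∧
      0 ∈ closure {x | onAxis x ∈ basin (P.shiftedField T) (onAxis (θ T))} ∧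
      ∀ φ ∉ basin (P.shiftedField T) (onAxis (θ T)),
        TheSolution (P.shiftedField T) φ fun u => limsupNorm u ≤ ENNReal.ofReal |σ T| := by
  have hα₁ := h.α₄_pos
  have hsqrt : √(P.disc T₁) = 3 * |P.a₂ T₁| := by
    rw [h.disc_eq, Real.sqrt_sq_eq_abs, abs_mul, abs_of_pos three_pos]
  have hev : ∀ᶠ T in 𝓝[<] T₁, 0 < P.α₄ T ∧ 0 < P.β₁ T ∧ P.β₂ T < 0 ∧
      3 * P.β₂ T < 2 * P.β₁ T := by
    filter_upwards [h.β₁_pos, nhdsWithin_le_nhds h.eventually_α₄_pos,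
      nhdsWithin_le_nhds h.eventually_β₂_neg, nhdsWithin_le_nhds h.eventually_β₂_lt_β₁]
      with T hb hα hc hcb using ⟨hα, hb, hc, hcb.2⟩
  rcases ha.lt_or_gt with ha | ha
  -- At `T₁` the square root equals `3|a₂|`. For negative `a₂` it cancels in `rootMinus`, the near
  -- state, and doubles in `rootPlus`, the far state; for positive `a₂` the roles are exchanged.
  · have h0 : P.rootMinus T₁ = 0 := by
      rw [rootMinus, hsqrt, abs_of_neg ha]; ring
    have h1 : 0 < |P.rootPlus T₁| := abs_pos.2 <| by
      rw [rootPlus, hsqrt, abs_of_neg ha]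
      have : 0 < 1 / (2 * P.α₄ T₁) := by positivity
      exact (mul_pos this (by linarith)).ne'
    refine ⟨P.rootMinus, P.rootPlus, |P.rootPlus T₁| / 2, half_pos h1, ?_, ?_⟩
    · have := h.rootMinus_cont.abs.tendsto
      rw [h0, abs_zero] at this
      exact this.mono_left nhdsWithin_le_nhds
    · filter_upwards [hev, nhdsWithin_le_nhds (h.rootPlus_cont.abs.eventually_const_lt
        (half_lt_self h1)), nhdsWithin_le_nhds (h.a₂_cont.eventually_lt_const ha)]
        with T ⟨hα, hb, hc, hcb⟩ hδ haT
      have hr := axisRoots_of_β₁_pos hα hb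
      refine ⟨hα, hδ.le, (hr.lt_left.trans hr.lt_right).ne, hr.stable_left hα hcb hc,
        hr.stable_right hα hcb hc, ?_, ?_, fun φ hφ =>
        (shiftedField_isDissipative hα).theSolution_iff.2 fun u hu => ?_⟩
      · rw [shiftedField_eq_glField, hr.basin_left hα, closure_Iio]
        exact mem_Iic.2 le_rfl
      · rw [shiftedField_eq_glField, hr.basin_right hα, closure_Ioi]
        exact mem_Ici.2 le_rfl
      · rw [abs_of_neg hr.lt_left]
        exact hr.limsupNorm_le_of_notMem_right hα haT hb hc hφ hu
  · have h0 : P.rootPlus T₁ = 0 := by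
      rw [rootPlus, hsqrt, abs_of_pos ha]; ring
    have h1 : 0 < |P.rootMinus T₁| := abs_pos.2 <| by
      rw [rootMinus, hsqrt, abs_of_pos ha]
      have : 0 < 1 / (2 * P.α₄ T₁) := by positivity
      exact (mul_neg_of_neg_of_pos (neg_lt_zero.2 this) (by linarith)).ne
    refine ⟨P.rootPlus, P.rootMinus, |P.rootMinus T₁| / 2, half_pos h1, ?_, ?_⟩
    · have := h.rootPlus_cont.abs.tendsto
      rw [h0, abs_zero] at this
      exact this.mono_left nhdsWithin_le_nhds
    · filter_upwards [hev, nhdsWithin_le_nhds (h.rootMinus_cont.abs.eventually_const_lt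
        (half_lt_self h1)), nhdsWithin_le_nhds (h.a₂_cont.eventually_const_lt ha)]
        with T ⟨hα, hb, hc, hcb⟩ hδ haT
      have hr := axisRoots_of_β₁_pos hα hb
      refine ⟨hα, hδ.le, (hr.lt_left.trans hr.lt_right).ne', hr.stable_right hα hcb hc,
        hr.stable_left hα hcb hc, ?_, ?_, fun φ hφ =>
        (shiftedField_isDissipative hα).theSolution_iff.2 fun u hu => ?_⟩
      · rw [shiftedField_eq_glField, hr.basin_right hα, closure_Ioi]
        exact mem_Ici.2 le_rfl
      · rw [shiftedField_eq_glField, hr.basin_left hα, closure_Iio]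
        exact mem_Iic.2 le_rfl
      · rw [abs_of_pos hr.lt_right]
        exact hr.limsupNorm_le_of_notMem_left hα haT hb hc hφ hu

theorem ofReal_le_limsupNorm_of_mem_basin {δ p : ℝ} (hδ : δ ≤ |p|) {φ : Magnetization}
    (hφ : φ ∈ basin (P.shiftedField T) (onAxis p)) :
    TheSolution (P.shiftedField T) φ fun u => ENNReal.ofReal δ ≤ limsupNorm u :=
  ⟨hφ.1, fun u hu => by
    beta_reduce
    rw [limsupNorm_eq_of_tendsto (hφ.2 u hu), ← ofReal_norm, norm_onAxis]
    exact ENNReal.ofReal_le_ofReal hδ⟩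

theorem hasMixedTransitionBelow (h : CriticalPoint P T₁) (ha : P.a₂ T₁ ≠ 0) :
    HasMixedTransitionBelow P.shiftedField T₁ := by
  obtain ⟨σ, θ, δ, hδ, hσ, hev⟩ := h.exists_near_and_far_state ha
  refine ⟨h.hasTransitionBelow, mixed_decomposition_of_isOpen hδ hσ
    (A := fun T => basin (P.shiftedField T) (onAxis (σ T)))
    (B := fun T => basin (P.shiftedField T) (onAxis (θ T))) ?_⟩
  filter_upwards [hev] with T ⟨hα, hδT, hne, hsσ, hsθ, hcσ, hcθ, hle⟩
  have hF := shiftedField_isDissipative hα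
  refine ⟨hF.isOpen_basin hsσ, hF.isOpen_basin hsθ, disjoint_basin (onAxis_injective.ne hne),
    ?_, ?_, hle, fun φ hφ => ofReal_le_limsupNorm_of_mem_basin hδT hφ⟩
  · rw [← onAxis_zero]
    exact map_mem_closure continuous_onAxis hcσ fun _ hx => hx
  · rw [← onAxis_zero]
    exact map_mem_closure continuous_onAxis hcθ fun _ hx => hx

theorem hasMixedTransitionBelow_axis (h : CriticalPoint P T₁) (ha : P.a₂ T₁ ≠ 0) :
    HasMixedTransitionBelow
      (fun T (x : axis) => axis.orthogonalProjectionOnto (P.shiftedField T (x : Magnetization)))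
      T₁ := by
  obtain ⟨σ, θ, δ, hδ, hσ, hev⟩ := h.exists_near_and_far_state ha
  refine ⟨h.hasTransitionBelow_axis, mixed_decomposition_of_isOpen hδ hσ
    (A := fun T => ((↑) : axis → Magnetization) ⁻¹' basin (P.shiftedField T) (onAxis (σ T)))
    (B := fun T => ((↑) : axis → Magnetization) ⁻¹' basin (P.shiftedField T) (onAxis (θ T))) ?_⟩
  filter_upwards [hev] with T ⟨hα, hδT, hne, hsσ, hsθ, hcσ, hcθ, hle⟩
  have hF := shiftedField_isDissipative hα
  have hcont : Continuous fun x => (⟨onAxis x, onAxis_mem_axis x⟩ : axis) :=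
    continuous_onAxis.subtype_mk _
  have hzero : (0 : axis) = ⟨onAxis 0, onAxis_mem_axis 0⟩ := Subtype.ext onAxis_zero.symm
  refine ⟨(hF.isOpen_basin hsσ).preimage continuous_subtype_val,
    (hF.isOpen_basin hsθ).preimage continuous_subtype_val,
    (disjoint_basin (onAxis_injective.ne hne)).preimage _, ?_, ?_,
    fun φ hφ => hF.theSolution_restrict shiftedField_mem_axis (hle φ hφ),
    fun φ hφ => hF.theSolution_restrict shiftedField_mem_axis
      (ofReal_le_limsupNorm_of_mem_basin hδT hφ)⟩
  · rw [hzero]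
    exact map_mem_closure hcont hcσ fun _ hx => hx
  · rw [hzero]
    exact map_mem_closure hcont hcθ fun _ hx => hx

theorem mixedTransitionOccursIn_axis (h : CriticalPoint P T₁) (ha : P.a₂ T₁ ≠ 0) :
    MixedTransitionOccursIn P.shiftedField T₁ axis := by
  refine ⟨?_, ⟨univ, univ_mem, ?_⟩, h.hasMixedTransitionBelow_axis ha⟩
  · filter_upwards [h.eventually_α₄_pos] with T hα φ hφ
    have hF := shiftedField_isDissipative hα
    exact ⟨shiftedField_mem_axis φ hφ, hF.theSolution_iff.2 fun u hu t ht =>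
      hF.mem_of_isSolution shiftedField_mem_axis hφ hu ht⟩
  · filter_upwards [h.eventually_α₄_pos, h.eventually_β₂_neg, h.eventually_β₂_lt_β₁]
      with T hα hc hcb φ _
    refine (shiftedField_isDissipative hα).theSolution_iff.2 fun u hu => ?_
    have h1 := (tendsto_transverse hα hc hcb.1 hu 1 (by decide)).abs
    have h2 := (tendsto_transverse hα hc hcb.1 hu 2 (by decide)).abs
    refine squeeze_zero (fun t => Metric.infDist_nonneg) (fun t => infDist_axis_le (u t)) ?_
    simpa using h1.add h2

end CriticalPoint

end Ferromagnet

theorem theorem4p1 (P : Ferromagnet) (I : Set ℝ) (hI : IsOpen I) (hP : P.Admissible I)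
    (T₁ : ℝ) (hT₁ : P.IsCriticalTemperature I T₁)
    (hlam : P.lam₁ T₁ > 2 * P.m₀ T₁ * (P.α₄ T₁ * P.m₀ T₁ - 2 * P.β T₁ * P.h))
    (ha : P.a₂ T₁ ≠ 0) :
    -- Type-III transition, occurring in the line `E`
    HasMixedTransitionBelow P.shiftedField T₁ ∧
    MixedTransitionOccursIn P.shiftedField T₁ Ferromagnet.axis ∧
    (∀ᶠ T in 𝓝 T₁, 0 < P.disc T) ∧
    -- the two stable equilibria near `T₁`
    (∀ᶠ T in 𝓝[<] T₁, P.StableStatesAre T (P.rootPlus T) (P.rootMinus T)) ∧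
    (0 < P.a₂ T₁ → ∀ᶠ T in 𝓝[>] T₁, P.StableStatesAre T 0 (P.rootMinus T)) ∧
    (P.a₂ T₁ < 0 → ∀ᶠ T in 𝓝[>] T₁, P.StableStatesAre T (P.rootPlus T) 0) ∧
    -- basins along `E` for `T < T₁`
    (∀ T ∈ I, T < T₁ →
      P.axisBasin T (P.rootPlus T) = Ioi 0 ∧ P.axisBasin T (P.rootMinus T) = Iio 0) ∧
    -- basins along `E` for `T > T₁`, if `a₂ > 0`
    (∀ T ∈ I, T₁ < T → 0 < P.a₂ T → 0 < P.disc T →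
      ∃ b : ℝ, b = 1 / (2 * P.α₄ T) * (3 * P.a₂ T - √(P.disc T)) ∧ 0 < b ∧
        P.axisBasin T 0 = Ioi (-b) ∧ P.axisBasin T (P.rootMinus T) = Iio (-b)) ∧
    -- basins along `E` for `T > T₁`, if `a₂ < 0` (the mirror image)
    (∀ T ∈ I, T₁ < T → P.a₂ T < 0 → 0 < P.disc T →
      ∃ b : ℝ, b = 1 / (2 * P.α₄ T) * (-3 * P.a₂ T - √(P.disc T)) ∧ 0 < b ∧
        P.axisBasin T 0 = Iio b ∧ P.axisBasin T (P.rootPlus T) = Ioi b) := by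
  have h := hP.criticalPoint hI hT₁ hlam
  refine ⟨h.hasMixedTransitionBelow ha, h.mixedTransitionOccursIn_axis ha,
    h.eventually_disc_pos ha, ?_, ?_, ?_, ?_, ?_, ?_⟩
  · filter_upwards [h.β₁_pos, nhdsWithin_le_nhds h.eventually_α₄_pos,
      nhdsWithin_le_nhds h.eventually_β₂_neg, nhdsWithin_le_nhds h.eventually_β₂_lt_β₁]
      with T hb hα hc hcb
    have hr := Ferromagnet.axisRoots_of_β₁_pos hα hb
    exact ⟨(hr.lt_left.trans hr.lt_right).ne', fun M =>
      (hr.stable_iff hα hcb.2 hcb.1 hc M).trans or_comm⟩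
  · intro ha
    filter_upwards [h.β₁_neg, nhdsWithin_le_nhds h.eventually_α₄_pos,
      nhdsWithin_le_nhds h.eventually_β₂_neg, nhdsWithin_le_nhds h.eventually_β₂_lt_β₁,
      nhdsWithin_le_nhds (h.a₂_cont.eventually_const_lt ha),
      nhdsWithin_le_nhds (h.eventually_disc_pos ha.ne')] with T hb hα hc hcb haT hd
    have hr := Ferromagnet.axisRoots_of_a₂_pos hα hb haT hd
    exact ⟨(hr.lt_left.trans hr.lt_right).ne', fun M =>
      (hr.stable_iff hα hcb.2 hcb.1 hc M).trans or_comm⟩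
  · intro ha
    filter_upwards [h.β₁_neg, nhdsWithin_le_nhds h.eventually_α₄_pos,
      nhdsWithin_le_nhds h.eventually_β₂_neg, nhdsWithin_le_nhds h.eventually_β₂_lt_β₁,
      nhdsWithin_le_nhds (h.a₂_cont.eventually_lt_const ha),
      nhdsWithin_le_nhds (h.eventually_disc_pos ha.ne)] with T hb hα hc hcb haT hd
    have hr := Ferromagnet.axisRoots_of_a₂_neg hα hb haT hd
    exact ⟨(hr.lt_left.trans hr.lt_right).ne', fun M =>
      (hr.stable_iff hα hcb.2 hcb.1 hc M).trans or_comm⟩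
  · intro T hT hlt
    have hα := hP.α₄_pos T hT
    have hr := Ferromagnet.axisRoots_of_β₁_pos hα (hP.β₁_pos hT₁ hT hlt)
    exact ⟨hr.basin_right hα, hr.basin_left hα⟩
  · intro T hT hlt haT hd
    have hα := hP.α₄_pos T hT
    have hr := Ferromagnet.axisRoots_of_a₂_pos hα (hP.β₁_neg hT₁ hT hlt) haT hd
    -- The threshold `-b` is the unstable middle root.
    have hb : 1 / (2 * P.α₄ T) * (3 * P.a₂ T - √(P.disc T)) = -P.rootPlus T := by
      rw [Ferromagnet.rootPlus]; ring
    refine ⟨_, rfl, ?_, ?_⟩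
    · rw [hb]
      exact neg_pos.2 hr.lt_right
    · rw [hb, neg_neg]
      exact ⟨hr.basin_right hα, hr.basin_left hα⟩
  · intro T hT hlt haT hd
    have hα := hP.α₄_pos T hT
    have hr := Ferromagnet.axisRoots_of_a₂_neg hα (hP.β₁_neg hT₁ hT hlt) haT hd
    have hb : 1 / (2 * P.α₄ T) * (-3 * P.a₂ T - √(P.disc T)) = P.rootMinus T := by
      rw [Ferromagnet.rootMinus]; ring
    refine ⟨_, rfl, ?_, ?_⟩
    · rw [hb]
      exact hr.lt_left
    · rw [hb]
      exact ⟨hr.basin_left hα, hr.basin_right hα⟩
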